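/- Let $S$ be an oriented surface with a smooth Riemannian metric $g$ of constant Gauss curvature, regarded as a Riemann surface with the complex structure induced by $g$: in each local holomorphic coordinate $z=x+iy$ one has $g=\lambda\,(dx^2+dy^2)$ with $\lambda>0$. Let $(p_x,p_y)$ be the momenta dual to $(x,y)$, $p=\tfrac12(p_x-ip_y)$, and let $H=\tfrac12 g^{ij}p_ip_j=\frac{p_x^2+p_y^2}{2\lambda}$ be the Hamiltonian of the geodesic flow. A cubic integral over an open set $U\subset S$ is a function $F$ on $T^*U$ that is in local coordinates a homogeneous polynomial of degree 3 in the momenta with smooth coefficients and satisfies $\{H,F\}=0$. Let $A=a(z)\,(\partial/\partial z)^{\otimes 3}$ be a holomorphic 3-codifferential on $S$, that is, a holomorphic section of $(T^{(1,0)}S)^{\otimes 3}$; its real part is the cubic form $\mathrm{Re}(A)=\mathrm{Re}(a\,p^3)$. We say that $A$ is compatible with $g$ on $U$ if there is a cubic integral $F$ over $U$ which has in local holomorphic coordinates the form $F=\mathrm{Re}(a\,p^3+b\,p^2\bar p)$ with a complex-valued function $b$. Put $D_0=4\,\mathrm{Re}(A_{;zzz})$, where $(\cdot)_{;z}$ is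 the $(1,0)$-part of the Levi-Civita covariant derivative, $\big(f\,(\partial/\partial z)^{\otimes k}\big)_{;z}=\big(f_z+k\,\tfrac{\lambda_z}{\lambda}f\big)(\partial/\partial z)^{\otimes (k-1)}$. **Proposition 3.1.** (i) Every point of $S$ has an open neighbourhood on which $A$ is compatible with $g$ if and only if $D_0=0$ on $S$. (ii) Let $U\subset S$ be a simply connected (in particular, connected) open set, for instance $U=S$ if $S$ is simply connected. Then $A$ is compatible with $g$ on $U$ if and only if $D_0=0$ on $U$. If this holds, then for every point $P\in U$, every tangent vector $v\in T_PS$ and every $w\in\mathbb R$ there exists a unique cubic integral over $U$ of the form $F=\mathrm{Re}(A)+2H\cdot b^ip_i$ with a smooth vector field $b=b^i\partial_{x^i}$ on $U$ such that $b(P)=v$ and $(\mathrm{rot}\,b)(P)=w$, where $\mathrm{rot}\,b=\frac1\lambda\big(\partial_x(\lambda b^2)-\partial_y(\lambda b^1)\big)$. Thus these integrals form a 3-parameter family. -/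

import Mathlib

open scoped Manifold ContDiff
open Complex Bundle

namespace CubicIntegrals

noncomputable section

/-!
A surface is modelled on `ℂ = ℝ²`. All charts of the atlas are holomorphic coordinates
`z = x + i y`, and the metric is isothermic in them, `g = λ (dx² + dy²)`; the complex structure is
thus the one that the metric and the orientation induce. The canonical coordinates on the cotangent
bundle that belong to a chart are `(x, y, p_x, p_y)`.
-/

/-- A smooth Riemannian metric on a surface `S` modelled on `ℂ = ℝ²`. -/
abbrev Metric (S : Type*) [TopologicalSpace S] [ChartedSpace ℂ S] [IsManifold 𝓘(ℝ, ℂ) ∞ S] :=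
  ContMDiffRiemannianMetric 𝓘(ℝ, ℂ) ∞ ℂ (fun p : S => TangentSpace 𝓘(ℝ, ℂ) p)

/-- The cotangent plane `T*_p S`. -/
abbrev Cotangent {S : Type*} [TopologicalSpace S] [ChartedSpace ℂ S] (p : S) :=
  TangentSpace 𝓘(ℝ, ℂ) p →L[ℝ] ℝ

section Coordinates

variable {S : Type*} [TopologicalSpace S] [ChartedSpace ℂ S]

/-- The set `φ(U ∩ dom φ)` of coordinate values of the points of `U` in the chart `φ`. -/
def chartImage (φ : OpenPartialHomeomorph S ℂ) (U : Set S) : Set ℂ :=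
  φ.target ∩ φ.symm ⁻¹' U

/-- The differential `dφ : T_p S → ℂ` of a chart. -/
def chartDeriv (φ : OpenPartialHomeomorph S ℂ) (p : S) : TangentSpace 𝓘(ℝ, ℂ) p →L[ℝ] ℂ :=
  mfderiv 𝓘(ℝ, ℂ) 𝓘(ℝ, ℂ) φ p

/-- The differential `ℂ → T_p S` of the inverse of a chart, `p = φ⁻¹(z)`;
it maps `1` to `∂/∂x` and `I` to `∂/∂y`. -/
def chartSymmDeriv (φ : OpenPartialHomeomorph S ℂ) (z : ℂ) :
    ℂ →L[ℝ] TangentSpace 𝓘(ℝ, ℂ) (φ.symm z) :=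
  mfderiv 𝓘(ℝ, ℂ) 𝓘(ℝ, ℂ) φ.symm z

/-- The covector `p_x dx + p_y dy` at the point `p`, where `x + i y = φ`. -/
def chartCovector (φ : OpenPartialHomeomorph S ℂ) (p : S) (px py : ℝ) : Cotangent p :=
  (px • reCLM + py • imCLM).comp (chartDeriv φ p)

/-- The expression of a function on `T*S` in the canonical coordinates `(z, p_x, p_y)`. -/
def chartExpr (F : (p : S) → Cotangent p → ℝ) (φ : OpenPartialHomeomorph S ℂ)
    (z : ℂ) (px py : ℝ) : ℝ :=
  F (φ.symm z) (chartCovector φ (φ.symm z) px py)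

/-- The components `b¹ + i b²` of a vector field in a chart. -/
def chartVector (b : (p : S) → TangentSpace 𝓘(ℝ, ℂ) p) (φ : OpenPartialHomeomorph S ℂ)
    (z : ℂ) : ℂ :=
  chartDeriv φ (φ.symm z) (b (φ.symm z))

end Coordinates

/-- `∂f/∂z = ½ (∂f/∂x - i ∂f/∂y)` for a function `f` that need not be holomorphic. -/
def dz (f : ℂ → ℂ) (z : ℂ) : ℂ :=
  (fderiv ℝ f z 1 - I * fderiv ℝ f z I) / 2

/-- The complex momentum `p = ½ (p_x - i p_y)`. -/
def complexMomentum (px py : ℝ) : ℂ := ((px : ℂ) - I * py) / 2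

/-- The canonical Poisson bracket of two functions of `(x, y, p_x, p_y)`, where `z = x + i y`. -/
def poissonBracket (H F : ℂ → ℝ → ℝ → ℝ) (z : ℂ) (px py : ℝ) : ℝ :=
  deriv (fun s => H z s py) px * fderiv ℝ (fun w => F w px py) z 1
    + deriv (fun s => H z px s) py * fderiv ℝ (fun w => F w px py) z I
    - fderiv ℝ (fun w => H w px py) z 1 * deriv (fun s => F z s py) px
    - fderiv ℝ (fun w => H w px py) z I * deriv (fun s => F z px s) py

section Metric

variable {S : Type*} [TopologicalSpace S] [ChartedSpace ℂ S] [IsManifold 𝓘(ℝ, ℂ) ∞ S]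

/-- The conformal factor `λ = g(∂/∂x, ∂/∂x)` of the metric in a chart. -/
def conformalFactor (g : Metric S) (φ : OpenPartialHomeomorph S ℂ) (z : ℂ) : ℝ :=
  g.inner (φ.symm z) (chartSymmDeriv φ z 1) (chartSymmDeriv φ z 1)

/-- In every chart of the atlas the metric has the isothermic form `g = λ (dx² + dy²)`. -/
def IsIsothermic (g : Metric S) : Prop :=
  ∀ φ ∈ atlas ℂ S, ∀ p ∈ φ.source, ∀ v w : TangentSpace 𝓘(ℝ, ℂ) p,
    g.inner p v w = conformalFactor g φ (φ p) *
      ((chartDeriv φ p v).re * (chartDeriv φ p w).re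
        + (chartDeriv φ p v).im * (chartDeriv φ p w).im)

/-- The Gauss curvature `R = - Δ(log λ) / (2 λ)` of `g = λ (dx² + dy²)`, as a function of the
isothermic coordinate. -/
def gaussCurvature (g : Metric S) (φ : OpenPartialHomeomorph S ℂ) (z : ℂ) : ℝ :=
  -(Laplacian.laplacian (fun w : ℂ => Real.log (conformalFactor g φ w)) z)
    / (2 * conformalFactor g φ z)

/-- The Gauss curvature is constant on the surface. -/
def HasConstantCurvature (g : Metric S) : Prop :=
  ∃ c : ℝ, ∀ φ ∈ atlas ℂ S, ∀ z ∈ φ.target, gaussCurvature g φ z = c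

/-- The Hamiltonian `H = ½ g^{ij} p_i p_j = (p_x² + p_y²) / (2 λ)` of the geodesic flow in the
canonical coordinates that belong to an isothermic chart. -/
def hamiltonian (g : Metric S) (φ : OpenPartialHomeomorph S ℂ) (z : ℂ) (px py : ℝ) : ℝ :=
  (px ^ 2 + py ^ 2) / (2 * conformalFactor g φ z)

/-- `F` is, over the open set `U`, an integral of the geodesic flow that is cubic in momenta. -/
def IsCubicIntegralOn (g : Metric S) (U : Set S) (F : (p : S) → Cotangent p → ℝ) : Prop :=
  ∀ φ ∈ atlas ℂ S,
    (∃ a₀ a₁ a₂ a₃ : ℂ → ℝ,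
      ContDiffOn ℝ ∞ a₀ (chartImage φ U) ∧ ContDiffOn ℝ ∞ a₁ (chartImage φ U) ∧
      ContDiffOn ℝ ∞ a₂ (chartImage φ U) ∧ ContDiffOn ℝ ∞ a₃ (chartImage φ U) ∧
      ∀ z ∈ chartImage φ U, ∀ px py : ℝ,
        chartExpr F φ z px py =
          a₀ z * px ^ 3 + a₁ z * px ^ 2 * py + a₂ z * px * py ^ 2 + a₃ z * py ^ 3) ∧
    ∀ z ∈ chartImage φ U, ∀ px py : ℝ,
      poissonBracket (hamiltonian g φ) (chartExpr F φ) z px py = 0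

end Metric

/-- A holomorphic 3-codifferential `A = a(z) (∂/∂z)^{⊗3}`, a holomorphic section of the third
tensor power of `T^{(1,0)}S`, given by its coefficients `a = coeff φ` in the charts. -/
structure HolomorphicCodifferential (S : Type*) [TopologicalSpace S] [ChartedSpace ℂ S] where
  /-- the coefficient `a` in a chart -/
  coeff : OpenPartialHomeomorph S ℂ → ℂ → ℂ
  holomorphic : ∀ φ ∈ atlas ℂ S, DifferentiableOn ℂ (coeff φ) φ.target
  transform : ∀ φ ∈ atlas ℂ S, ∀ ψ ∈ atlas ℂ S, ∀ p ∈ φ.source ∩ ψ.source,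
    coeff ψ (ψ p) = coeff φ (φ p) * (deriv (ψ ∘ φ.symm) (φ p)) ^ 3

section Codifferential

variable {S : Type*} [TopologicalSpace S] [ChartedSpace ℂ S]

/-- `Re A` as a cubic form in the momenta, `Re (a p³)` in the coordinates of a chart. -/
def HolomorphicCodifferential.rePart (A : HolomorphicCodifferential S)
    (φ : OpenPartialHomeomorph S ℂ) (z : ℂ) (px py : ℝ) : ℝ :=
  (A.coeff φ z * complexMomentum px py ^ 3).re

/-- `A` is over `U` the Birkhoff-Kolokoltsov 3-codifferential of the cubic form `F`: in every chart
`F = Re (a p³ + b p² p̄)` with `A = a (∂/∂z)^{⊗3}`. -/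
def IsBirkhoffKolokoltsovOn (A : HolomorphicCodifferential S) (U : Set S)
    (F : (p : S) → Cotangent p → ℝ) : Prop :=
  ∀ φ ∈ atlas ℂ S, ∀ z ∈ chartImage φ U, ∃ b : ℂ, ∀ px py : ℝ,
    chartExpr F φ z px py =
      (A.coeff φ z * complexMomentum px py ^ 3
        + b * complexMomentum px py ^ 2 * star (complexMomentum px py)).re

/-- Smooth vector fields over the open set `U`. -/
def IsSmoothVectorFieldOn (U : Set S) (b : (p : S) → TangentSpace 𝓘(ℝ, ℂ) p) : Prop :=
  ∀ φ ∈ atlas ℂ S, ContDiffOn ℝ ∞ (chartVector b φ) (chartImage φ U)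

variable [IsManifold 𝓘(ℝ, ℂ) ∞ S]

/-- `A` is compatible with `g` over the open set `U`: it is the Birkhoff-Kolokoltsov
3-codifferential of some cubic integral. -/
def IsCompatibleOn (g : Metric S) (A : HolomorphicCodifferential S) (U : Set S) : Prop :=
  ∃ F : (p : S) → Cotangent p → ℝ, IsCubicIntegralOn g U F ∧ IsBirkhoffKolokoltsovOn A U F

/-- The coefficient of the `(1,0)`-part `∇^{(1,0)}(f (∂/∂z)^{⊗k}) = (f_z + k (λ_z / λ) f)
(∂/∂z)^{⊗(k-1)}` of the metric covariant derivative. -/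
def covDz (g : Metric S) (φ : OpenPartialHomeomorph S ℂ) (k : ℕ) (f : ℂ → ℂ) (z : ℂ) : ℂ :=
  dz f z + k * (dz (fun w => (conformalFactor g φ w : ℂ)) z / conformalFactor g φ z) * f z

/-- The function `D₀ = 4 Re (A_{;zzz})` in the coordinate of a chart. -/
def D₀ (g : Metric S) (A : HolomorphicCodifferential S) (φ : OpenPartialHomeomorph S ℂ)
    (z : ℂ) : ℝ :=
  4 * (covDz g φ 1 (covDz g φ 2 (covDz g φ 3 (A.coeff φ))) z).re

/-- `D₀ = 0` on `U`. -/
def D₀VanishesOn (g : Metric S) (A : HolomorphicCodifferential S) (U : Set S) : Prop :=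
  ∀ φ ∈ atlas ℂ S, ∀ z ∈ chartImage φ U, D₀ g A φ z = 0

/-- The rotor `rot b = (∂_x b_y - ∂_y b_x) / λ` at the point `p`, where `b_i = g_{ij} b^j` and `λ`
is the density of the area form; it does not depend on the isothermic chart. -/
def rot (g : Metric S) (b : (p : S) → TangentSpace 𝓘(ℝ, ℂ) p) (p : S) : ℝ :=
  let φ := chartAt ℂ p
  (fderiv ℝ (fun w => conformalFactor g φ w * (chartVector b φ w).im) (φ p) 1
    - fderiv ℝ (fun w => conformalFactor g φ w * (chartVector b φ w).re) (φ p) I)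
    / conformalFactor g φ (φ p)

/-- `F = Re A + 2 H b^i p_i` over `U`. -/
def HasFormOn (g : Metric S) (A : HolomorphicCodifferential S)
    (b : (p : S) → TangentSpace 𝓘(ℝ, ℂ) p) (U : Set S)
    (F : (p : S) → Cotangent p → ℝ) : Prop :=
  ∀ φ ∈ atlas ℂ S, ∀ z ∈ chartImage φ U, ∀ px py : ℝ,
    chartExpr F φ z px py = A.rePart φ z px py
      + 2 * hamiltonian g φ z px py * ((chartVector b φ z).re * px + (chartVector b φ z).im * py)

/-- `F` is a cubic integral over `U` of the form `Re A + 2 H b^i p_i`, where the smooth vector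
field `b` has the values `b(P) = v` and `(rot b)(P) = w`. -/
def IsIntegralWithData (g : Metric S) (A : HolomorphicCodifferential S) (U : Set S) (P : S)
    (v : TangentSpace 𝓘(ℝ, ℂ) P) (w : ℝ) (F : (p : S) → Cotangent p → ℝ) : Prop :=
  IsCubicIntegralOn g U F ∧
    ∃ b : (p : S) → TangentSpace 𝓘(ℝ, ℂ) p,
      IsSmoothVectorFieldOn U b ∧ HasFormOn g A b U F ∧ b P = v ∧ rot g b P = w

end Codifferential

end

end CubicIntegrals

open CubicIntegrals

/-! In an isothermic coordinate put β = b¹ + i b² and ℓ = λ_z/λ. Since 2H = 4|p|²/λ and b^i p_i = 2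
Re(βp), the form Re A + 2H b^i p_i equals Re(a p³ + (8β/λ) p² p̄). Its bracket with H is the real
part of a quartic in p and p̄, and it vanishes exactly when β_z̄ = -λA_{;z}/8 and Re(β_z + ℓβ) = 0
(`IsothermicData.poissonBracket_eq_zero_iff`). The only first derivative left free is Im(β_z + ℓβ),
which is half the rotor ρ, so β_z = -ℓβ + iρ/2.

Equality of the mixed derivatives of β then determines dρ: with K the curvature, ρ_z̄ = i(Kλβ +
λA_{;zz}/4) (`hasWirtingerAt_rotor`). All first derivatives of (β, ρ) are now affine functions of
(β, ρ). Since K is constant, the one remaining integrability condition is that ρ_{zz̄} be real, that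
is, Re (λA_{;zz})_z = λ Re A_{;zzz} = 0. This is D₀ = 0: it is necessary by `re_dz_R_eq_zero`, and
it makes the system flat by `rotorSystem_flat`.

For a flat linear system, Frobenius (`exists_ball_hasFDerivAt_linear`) gives a unique local solution
for each value of (β, ρ) at a point, which is three real parameters. The system is invariant under
holomorphic coordinate changes (`IsRotorSolutionAt.coordinate_change`), so its solutions live on the
surface. On a simply connected domain they have no monodromy and continue to the whole domain
(`IsSimplyConnected.exists_forall_of_locally_existsUnique`). -/

set_option maxSynthPendingDepth 3
set_option linter.unusedSectionVars false

/-! ### Linear ordinary differential equations on the unit interval. -/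

section LinearODE

variable {E : Type*} [NormedAddCommGroup E] [NormedSpace ℝ E]

lemma exists_solution_linear_ODE [CompleteSpace E] {B : ℝ → E →L[ℝ] E}
    (hB : ContinuousOn B (Set.Icc 0 1)) (hb : ∀ t ∈ Set.Icc (0 : ℝ) 1, ‖B t‖ ≤ 1 / 2) (v : E) :
    ∃ w : ℝ → E, w 0 = v ∧
      ∀ t ∈ Set.Icc (0 : ℝ) 1, HasDerivWithinAt w (B t (w t)) (Set.Icc 0 1) t := by
  -- On the ball of radius ‖v‖ about v one has ‖x‖ ≤ 2‖v‖, so the bound 1/2 on ‖B t‖ limits the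
  -- speed to ‖v‖ and the solution stays in the ball for unit time.
  have h : IsPicardLindelof (fun t x => B t x) (⟨0, by simp⟩ : Set.Icc (0 : ℝ) 1) v
      ‖v‖₊ 0 ‖v‖₊ 1 := by
    refine ⟨fun t ht => ?_, fun x _ => hB.clm_apply continuousOn_const, fun t ht x hx => ?_, ?_⟩
    · refine ((B t).lipschitz.weaken ?_).lipschitzOnWith
      have := hb t ht
      exact NNReal.coe_le_coe.1 (by simpa using this.trans (by norm_num))
    · have h1 : ‖x - v‖ ≤ ‖v‖ := by simpa [dist_eq_norm] using hx
      have h2 : ‖x‖ ≤ 2 * ‖v‖ := by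
        have := norm_add_le (x - v) v
        rw [sub_add_cancel] at this
        linarith
      calc ‖B t x‖ ≤ ‖B t‖ * ‖x‖ := (B t).le_opNorm x
        _ ≤ 1 / 2 * (2 * ‖v‖) := by gcongr; exact hb t ht
        _ = ((‖v‖₊ : NNReal) : ℝ) := by simp
    · simp
  exact h.exists_eq_forall_mem_Icc_hasDerivWithinAt₀

lemma HasDerivWithinAt.Ici_of_Icc {f : ℝ → E} {f' : E} {a b t : ℝ}
    (h : HasDerivWithinAt f f' (Set.Icc a b) t) (ht : t ∈ Set.Ico a b) :
    HasDerivWithinAt f f' (Set.Ici t) t :=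
  h.mono_of_mem_nhdsWithin (Icc_mem_nhdsGE_of_mem ht)

end LinearODE


/-! ### Frobenius' theorem for flat linear systems du = M(z)u. -/

section Frobenius

variable {X E : Type*} [NormedAddCommGroup X] [NormedSpace ℝ X] [NormedAddCommGroup E]
  [NormedSpace ℝ E]

/-- Along a segment from y the difference of two solutions satisfies a homogeneous linear equation
with zero initial value, so Gronwall's inequality makes it vanish. -/
lemma eqOn_of_hasFDerivAt_linear {s : Set X} (hs : Convex ℝ s) {M : X → E →L[ℝ] X →L[ℝ] E}
    (hM : ContinuousOn M s) {u₁ u₂ : X → E}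
    (h₁ : ∀ z ∈ s, HasFDerivAt u₁ (M z (u₁ z)) z)
    (h₂ : ∀ z ∈ s, HasFDerivAt u₂ (M z (u₂ z)) z) {y : X} (hy : y ∈ s)
    (h : u₁ y = u₂ y) : Set.EqOn u₁ u₂ s := by
  intro z hz
  have hseg : ∀ t ∈ Set.Icc (0 : ℝ) 1, y + t • (z - y) ∈ s := fun t ht =>
    hs.add_smul_sub_mem hy hz ht
  have hpath : ∀ t : ℝ, HasDerivAt (fun t : ℝ => y + t • (z - y)) (z - y) t := fun t => by
    simpa using ((hasDerivAt_id t).smul_const (z - y)).const_add y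
  have hMc : ContinuousOn (fun t : ℝ => M (y + t • (z - y))) (Set.Icc 0 1) :=
    hM.comp (by fun_prop) hseg
  obtain ⟨C, hC⟩ := isCompact_Icc.exists_bound_of_continuousOn hMc
  have hd : ∀ t ∈ Set.Icc (0 : ℝ) 1,
      HasDerivAt (fun t : ℝ => u₁ (y + t • (z - y)) - u₂ (y + t • (z - y)))
        (M (y + t • (z - y)) (u₁ (y + t • (z - y)) - u₂ (y + t • (z - y))) (z - y)) t := by
    intro t ht
    have a1 := (h₁ _ (hseg t ht)).comp_hasDerivAt t (hpath t)
    have a2 := (h₂ _ (hseg t ht)).comp_hasDerivAt t (hpath t)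
    exact (a1.sub a2).congr_deriv (by simp only [map_sub, sub_apply]; abel)
  have := eq_zero_of_abs_deriv_le_mul_abs_self_of_eq_zero_right (K := C * ‖z - y‖)
    (fun t ht => (hd t ht).continuousAt.continuousWithinAt)
    (fun t ht => (hd t (Set.Ico_subset_Icc_self ht)).hasDerivWithinAt) (by simp [h])
    (fun t ht => ?_) 1 (by simp)
  · simpa [sub_eq_zero] using this
  · refine ((M _).le_opNorm₂ _ _).trans ?_
    rw [mul_right_comm]
    gcongr
    exact hC t (Set.Ico_subset_Icc_self ht)

/-- The derivative of the endpoint of the solution of a flat linear system along rays, by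
comparing the solution along a neighbouring ray with its linear approximation. -/
lemma norm_ray_solution_sub_le {s : Set X} (hs : Convex ℝ s)
    {M : X → E →L[ℝ] X →L[ℝ] E} {M' : X → X →L[ℝ] E →L[ℝ] X →L[ℝ] E}
    (hM : ∀ z ∈ s, HasFDerivAt M (M' z) z) {C : ℝ} (hC : ∀ z ∈ s, ‖M z‖ ≤ C)
    (hC' : ∀ z ∈ s, ‖M' z‖ ≤ C) (hL : ∀ z ∈ s, ∀ w ∈ s, ‖M' z - M' w‖ ≤ C * ‖z - w‖)
    (hflat : ∀ z ∈ s, ∀ h k u, M' z h u k + M z (M z u h) k = M' z k u h + M z (M z u k) h)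
    {y z h : X} (hy : y ∈ s) (hz : z ∈ s) (hzh : z + h ∈ s) {W V : ℝ → E} {B D : ℝ}
    (hWV : W 0 = V 0)
    (hW : ∀ t ∈ Set.Icc (0 : ℝ) 1, HasDerivWithinAt W (M (y + t • (z - y)) (W t) (z - y))
      (Set.Icc 0 1) t)
    (hV : ∀ t ∈ Set.Icc (0 : ℝ) 1, HasDerivWithinAt V
      (M (y + t • (z + h - y)) (V t) (z + h - y)) (Set.Icc 0 1) t)
    (hB : ∀ t ∈ Set.Icc (0 : ℝ) 1, ‖W t‖ ≤ B) (hD : ‖z + h - y‖ ≤ D) :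
    ‖V 1 - (W 1 + M z (W 1) h)‖ ≤
      gronwallBound 0 (C * D) (C * B + C * D * B + C * (C + C * D) * B) 1 * ‖h‖ ^ 2 := by
  have hC0 : 0 ≤ C := (norm_nonneg _).trans (hC y hy)
  have hD0 : 0 ≤ D := (norm_nonneg _).trans hD
  have hB0 : 0 ≤ B := (norm_nonneg _).trans (hB 0 (by simp))
  set d := z - y with hd
  have hdh : z + h - y = d + h := by rw [hd]; abel
  rw [hdh] at hV hD
  have hseg : ∀ t ∈ Set.Icc (0 : ℝ) 1, y + t • d ∈ s := fun t ht =>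
    hs.add_smul_sub_mem hy hz ht
  have hseg' : ∀ t ∈ Set.Icc (0 : ℝ) 1, y + t • (d + h) ∈ s := fun t ht => by
    rw [← hdh]; exact hs.add_smul_sub_mem hy hzh ht
  have hpath : ∀ t : ℝ, HasDerivAt (fun t : ℝ => y + t • d) d t := fun t => by
    simpa using ((hasDerivAt_id t).smul_const d).const_add y
  -- the linear approximation along the neighbouring ray
  have hY : ∀ t ∈ Set.Icc (0 : ℝ) 1, HasDerivWithinAt
      (fun t => W t + t • M (y + t • d) (W t) h)
      (M (y + t • d) (W t) d + (M (y + t • d) (W t) h + t • (M' (y + t • d) d (W t) h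
        + M (y + t • d) (M (y + t • d) (W t) d) h))) (Set.Icc 0 1) t := by
    intro t ht
    have hm : HasDerivWithinAt (fun t : ℝ => M (y + t • d)) (M' (y + t • d) d)
        (Set.Icc 0 1) t := ((hM _ (hseg t ht)).comp_hasDerivAt t (hpath t)).hasDerivWithinAt
    have := (hW t ht).add ((hasDerivWithinAt_id t _).smul
      ((hm.clm_apply (hW t ht)).clm_apply (hasDerivWithinAt_const t _ h)))
    refine this.congr_deriv ?_
    simp
    abel
  -- The approximation solves the equation of the neighbouring ray up to O(‖h‖²). Flatness exchanges
  -- the roles of d and h, and the result cancels the first-order Taylor expansion of M at p applied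
  -- to the approximation; the three constants bound what remains.
  have hkey : ∀ t ∈ Set.Icc (0 : ℝ) 1,
      ‖(M (y + t • d) (W t) d + (M (y + t • d) (W t) h + t • (M' (y + t • d) d (W t) h
        + M (y + t • d) (M (y + t • d) (W t) d) h)))
        - M (y + t • (d + h)) (W t + t • M (y + t • d) (W t) h) (d + h)‖
      ≤ (C * B + C * D * B + C * (C + C * D) * B) * ‖h‖ ^ 2 := by
    intro t ht
    have hp := hseg t ht
    have hq := hseg' t ht
    set p := y + t • d with hpdef
    set q := y + t • (d + h) with hqdef
    have hqp : q - p = t • h := by simp only [hpdef, hqdef, smul_add]; abel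
    have ht1 : ‖t • h‖ ≤ ‖h‖ := by
      rw [norm_smul, Real.norm_of_nonneg ht.1]
      exact mul_le_of_le_one_left (norm_nonneg _) ht.2
    have hR : ‖M q - M p - M' p (t • h)‖ ≤ C * ‖h‖ ^ 2 := by
      have := (convex_segment p q).norm_image_sub_le_of_norm_hasFDerivWithin_le' (f := M)
        (f' := M') (φ := M' p) (C := C * ‖t • h‖)
        (fun x hx => (hM x (hs.segment_subset hp hq hx)).hasFDerivWithinAt)
        (fun x hx => (hL x (hs.segment_subset hp hq hx) p hp).trans (by
          gcongr
          rw [← hqp]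
          obtain ⟨θ, hθ, rfl⟩ := (segment_eq_image' ℝ p q) ▸ hx
          rw [add_sub_cancel_left, norm_smul, Real.norm_of_nonneg hθ.1]
          exact mul_le_of_le_one_left (norm_nonneg _) hθ.2))
        (left_mem_segment ℝ p q) (right_mem_segment ℝ p q)
      rw [hqp] at this
      refine this.trans ?_
      rw [mul_assoc, ← sq]
      gcongr
    have hMM : ‖M q - M p‖ ≤ C * ‖h‖ := by
      have := (convex_segment p q).norm_image_sub_le_of_norm_hasFDerivWithin_le (f := M)
        (f' := M') (C := C)
        (fun x hx => (hM x (hs.segment_subset hp hq hx)).hasFDerivWithinAt)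
        (fun x hx => hC' x (hs.segment_subset hp hq hx))
        (left_mem_segment ℝ p q) (right_mem_segment ℝ p q)
      rw [hqp] at this
      exact this.trans (by gcongr)
    have hfl := hflat p hp h d (W t)
    have hsplit : (M p (W t) d + (M p (W t) h + t • (M' p d (W t) h + M p (M p (W t) d) h)))
        - M q (W t + t • M p (W t) h) (d + h)
        = -(t • M' p h (W t) h + (M q - M p - M' p (t • h)) (W t) (d + h)
          + (M p (t • M p (W t) h) h + (M q - M p) (t • M p (W t) h) (d + h))) := by
      rw [← hfl]
      simp only [map_add, map_smul, add_apply, sub_apply, smul_apply, smul_add, smul_sub]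
      abel
    rw [hsplit, norm_neg]
    have hWt := hB t ht
    have ht' : ‖t‖ ≤ 1 := by rw [Real.norm_of_nonneg ht.1]; exact ht.2
    have e1 : ‖t • M' p h (W t) h‖ ≤ C * B * ‖h‖ ^ 2 := by
      calc ‖t • M' p h (W t) h‖ ≤ ‖t‖ * (‖M' p‖ * ‖h‖ * ‖W t‖ * ‖h‖) := by
            rw [norm_smul]; gcongr
            exact ((M' p h).le_opNorm₂ _ _).trans (by gcongr; exact (M' p).le_opNorm h)
        _ ≤ 1 * (C * ‖h‖ * B * ‖h‖) := by gcongr; exact hC' p hp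
        _ = _ := by ring
    have e2 : ‖(M q - M p - M' p (t • h)) (W t) (d + h)‖ ≤ C * D * B * ‖h‖ ^ 2 := by
      calc _ ≤ ‖M q - M p - M' p (t • h)‖ * ‖W t‖ * ‖d + h‖ :=
            ContinuousLinearMap.le_opNorm₂ _ _ _
        _ ≤ (C * ‖h‖ ^ 2) * B * D := by gcongr
        _ = _ := by ring
    have e3 : ‖(M p (t • M p (W t) h) h + (M q - M p) (t • M p (W t) h) (d + h))‖
        ≤ C * (C + C * D) * B * ‖h‖ ^ 2 := by
      have a2 : ‖t • M p (W t) h‖ ≤ C * B * ‖h‖ := by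
        calc _ ≤ ‖t‖ * (‖M p‖ * ‖W t‖ * ‖h‖) := by
              rw [norm_smul]; gcongr; exact (M p).le_opNorm₂ _ _
          _ ≤ 1 * (C * B * ‖h‖) := by gcongr; exact hC p hp
          _ = _ := by ring
      calc _ ≤ C * (C * B * ‖h‖) * ‖h‖ + C * ‖h‖ * (C * B * ‖h‖) * D := by
            refine (norm_add_le _ _).trans (add_le_add ?_ ?_)
            · exact ((M p).le_opNorm₂ _ _).trans (by gcongr; exact hC p hp)
            · exact ((M q - M p).le_opNorm₂ _ _).trans (by gcongr)
        _ = _ := by ring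
    calc _ ≤ C * B * ‖h‖ ^ 2 + C * D * B * ‖h‖ ^ 2 + C * (C + C * D) * B * ‖h‖ ^ 2 :=
          norm_add₃_le.trans (add_le_add (add_le_add e1 e2) e3)
      _ = _ := by ring
  have hgr := norm_le_gronwallBound_of_norm_deriv_right_le (δ := 0) (K := C * D)
    (ε := (C * B + C * D * B + C * (C + C * D) * B) * ‖h‖ ^ 2)
    (f := fun t => (W t + t • M (y + t • d) (W t) h) - V t)
    (fun t ht => ((hY t ht).sub (hV t ht)).continuousWithinAt)
    (fun t ht => ((hY t (Set.Ico_subset_Icc_self ht)).sub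
      (hV t (Set.Ico_subset_Icc_self ht))).Ici_of_Icc ht) (by simp [hWV]) (fun t ht => ?_) 1
    (by simp)
  · rw [norm_sub_rev]
    have hz1 : y + d = z := by simp [hd]
    simp only [one_smul, sub_zero, hz1] at hgr
    refine hgr.trans (le_of_eq ?_)
    -- With zero initial error the Gronwall bound is linear in ε, so ‖h‖² factors out.
    unfold gronwallBound
    split_ifs <;> ring
  · have ht' := Set.Ico_subset_Icc_self ht
    have hq := hseg' t ht'
    have e : ∀ a b Yt : E, a - M (y + t • (d + h)) b (d + h) =
        M (y + t • (d + h)) (Yt - b) (d + h) + (a - M (y + t • (d + h)) Yt (d + h)) := by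
      intro a b Yt; rw [map_sub, sub_apply]; abel
    rw [e _ _ (W t + t • M (y + t • d) (W t) h)]
    refine (norm_add_le _ _).trans (add_le_add ?_ (hkey t ht'))
    refine (ContinuousLinearMap.le_opNorm₂ _ _ _).trans ?_
    rw [mul_right_comm]
    gcongr
    exact hC _ hq

/-- The candidate u(z) is the value at time 1 of the solution along the ray from y to z. Only its
radial derivative is known by construction; the quadratic estimate of `norm_ray_solution_sub_le`,
which rests on flatness, gives the full derivative. -/
theorem exists_hasFDerivAt_linear [CompleteSpace E] {s : Set X} (hs : Convex ℝ s) (ho : IsOpen s)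
    {M : X → E →L[ℝ] X →L[ℝ] E} {M' : X → X →L[ℝ] E →L[ℝ] X →L[ℝ] E}
    (hM : ∀ z ∈ s, HasFDerivAt M (M' z) z) {C : ℝ} (hC : ∀ z ∈ s, ‖M z‖ ≤ C)
    (hC' : ∀ z ∈ s, ‖M' z‖ ≤ C) (hL : ∀ z ∈ s, ∀ w ∈ s, ‖M' z - M' w‖ ≤ C * ‖z - w‖)
    (hflat : ∀ z ∈ s, ∀ h k u, M' z h u k + M z (M z u h) k = M' z k u h + M z (M z u k) h)
    (hsmall : ∀ z ∈ s, ∀ w ∈ s, C * ‖z - w‖ ≤ 1 / 2) {y : X} (hy : y ∈ s) (v : E) :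
    ∃ u : X → E, u y = v ∧ ∀ z ∈ s, HasFDerivAt u (M z (u z)) z := by
  have hex : ∀ z : X, ∃ w : ℝ → E, w 0 = v ∧ (z ∈ s → ∀ t ∈ Set.Icc (0 : ℝ) 1,
      HasDerivWithinAt w (M (y + t • (z - y)) (w t) (z - y)) (Set.Icc 0 1) t) := by
    intro z
    by_cases hz : z ∈ s
    · have hseg : ∀ t ∈ Set.Icc (0 : ℝ) 1, y + t • (z - y) ∈ s := fun t ht =>
        hs.add_smul_sub_mem hy hz ht
      have hMc : ContinuousOn M s := fun x hx => (hM x hx).continuousAt.continuousWithinAt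
      have hb : ∀ t ∈ Set.Icc (0 : ℝ) 1,
          ‖(ContinuousLinearMap.apply ℝ E (z - y)).comp (M (y + t • (z - y)))‖ ≤ 1 / 2 := by
        intro t ht
        refine le_trans (ContinuousLinearMap.opNorm_le_bound _ ?_ fun x => ?_) (hsmall z hz y hy)
        · exact mul_nonneg ((norm_nonneg _).trans (hC y hy)) (norm_nonneg _)
        · refine ((M _).le_opNorm₂ _ _).trans ?_
          rw [mul_right_comm]
          gcongr
          exact hC _ (hseg t ht)
      obtain ⟨w, h0, hw⟩ := exists_solution_linear_ODE
        (continuousOn_const.clm_comp (hMc.comp (by fun_prop) hseg)) hb v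
      exact ⟨w, h0, fun _ => hw⟩
    · exact ⟨fun _ => v, rfl, fun h => absurd h hz⟩
  choose U hU0 hU using hex
  refine ⟨fun z => U z 1, ?_, fun z hz => ?_⟩
  -- The ray from y to itself is stationary, so its solution is constant.
  · have hd := hU y hy
    simp only [sub_self, map_zero] at hd
    rw [← hU0 y]
    exact constant_of_derivWithin_zero (fun t ht => (hd t ht).differentiableWithinAt)
      (fun t ht => (hd t (Set.Ico_subset_Icc_self ht)).derivWithin
        ((uniqueDiffOn_Icc zero_lt_one) t (Set.Ico_subset_Icc_self ht))) 1 (by simp)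
  · obtain ⟨B, hB⟩ := isCompact_Icc.exists_bound_of_continuousOn
      (fun t ht => (hU z hz t ht).continuousWithinAt)
    have hev : ∀ᶠ h in nhds (0 : X), z + h ∈ s ∧ ‖h‖ ≤ 1 := by
      refine (((continuous_const.add continuous_id).tendsto' (0 : X) z (by simp)).eventually
        (ho.mem_nhds hz)).and ?_
      filter_upwards [Metric.closedBall_mem_nhds (0 : X) one_pos] with h hh
      simpa using hh
    rw [hasFDerivAt_iff_isLittleO_nhds_zero]
    have hO : (fun h : X => U (z + h) 1 - U z 1 - M z (U z 1) h) =O[nhds 0]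
        fun h => ‖h‖ ^ 2 := by
      refine Asymptotics.IsBigO.of_bound (gronwallBound 0 (C * (‖z - y‖ + 1))
        (C * B + C * (‖z - y‖ + 1) * B + C * (C + C * (‖z - y‖ + 1)) * B) 1) ?_
      filter_upwards [hev] with h hh
      have := norm_ray_solution_sub_le hs hM hC hC' hL hflat hy hz hh.1
        ((hU0 z).trans (hU0 (z + h)).symm) (hU z hz) (hU (z + h) hh.1) hB
        (D := ‖z - y‖ + 1) (by
          rw [add_sub_right_comm]
          exact (norm_add_le _ _).trans (by gcongr; exact hh.2))
      rw [Real.norm_of_nonneg (by positivity), sub_sub]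
      exact this
    refine hO.trans_isLittleO ?_
    simpa using (Asymptotics.isLittleO_norm_pow_id (E' := X) one_lt_two)

theorem exists_ball_hasFDerivAt_linear [CompleteSpace E] {O : Set X} (hO : IsOpen O)
    {M : X → E →L[ℝ] X →L[ℝ] E} (hM : ContDiffOn ℝ ∞ M O)
    (hflat : ∀ z ∈ O, ∀ h k u, fderiv ℝ M z h u k + M z (M z u h) k
      = fderiv ℝ M z k u h + M z (M z u k) h) {z₀ : X} (hz₀ : z₀ ∈ O) :
    ∃ r > 0, Metric.ball z₀ r ⊆ O ∧ ∀ y ∈ Metric.ball z₀ r, ∀ v : E,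
      ∃ u : X → E, u y = v ∧ ∀ z ∈ Metric.ball z₀ r, HasFDerivAt u (M z (u z)) z := by
  have hM0 : ContDiffAt ℝ ∞ M z₀ := hM.contDiffAt (hO.mem_nhds hz₀)
  have hM1 : ContDiffAt ℝ 1 (fderiv ℝ M) z₀ := 
    (hM0.fderiv_right (m := ∞) le_rfl).of_le (by simp)
  obtain ⟨K, t, ht, hK⟩ := hM1.exists_lipschitzOnWith
  have hb1 := hM0.continuousAt.norm.eventually_lt_const (lt_add_one ‖M z₀‖)
  have hb2 := hM1.continuousAt.norm.eventually_lt_const (lt_add_one ‖fderiv ℝ M z₀‖)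
  obtain ⟨ρ, hρ, hρs⟩ := Metric.eventually_nhds_iff_ball.1
    (((hO.eventually_mem hz₀).and (Filter.eventually_mem_set.2 ht)).and
      (hb1.and hb2))
  -- One constant serves for the bounds on M and its derivative and for the Lipschitz constant of
  -- the latter. The radius 1/(4C) makes C times the diameter at most 1/2.
  set C : ℝ := K + (‖M z₀‖ + 1) + (‖fderiv ℝ M z₀‖ + 1) with hCdef
  have hCpos : 0 < C := by positivity
  have hK0 : (0 : ℝ) ≤ K := K.2
  refine ⟨min ρ (1 / (4 * C)), by positivity, fun z hz => ?_, fun y hy v => ?_⟩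
  · exact (hρs z (Metric.ball_subset_ball (min_le_left _ _) hz)).1.1
  have hr : ∀ z ∈ Metric.ball z₀ (min ρ (1 / (4 * C))), z ∈ Metric.ball z₀ ρ := fun z hz =>
    Metric.ball_subset_ball (min_le_left _ _) hz
  refine exists_hasFDerivAt_linear (convex_ball _ _) Metric.isOpen_ball (M' := fderiv ℝ M) (C := C)
    (fun z hz => ?_) (fun z hz => ?_) (fun z hz => ?_) (fun z hz w hw => ?_)
    (fun z hz => hflat z (hρs z (hr z hz)).1.1) (fun z hz w hw => ?_) hy v
  · exact ((hM.contDiffAt (hO.mem_nhds (hρs z (hr z hz)).1.1)).differentiableAt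
      (by simp)).hasFDerivAt
  · have := (hρs z (hr z hz)).2.1
    have := norm_nonneg (fderiv ℝ M z₀)
    linarith
  · have := (hρs z (hr z hz)).2.2
    have := norm_nonneg (M z₀)
    linarith
  · have := hK.dist_le_mul z (hρs z (hr z hz)).1.2 w (hρs w (hr w hw)).1.2
    rw [dist_eq_norm, dist_eq_norm] at this
    refine this.trans ?_
    gcongr
    rw [hCdef]
    have := norm_nonneg (fderiv ℝ M z₀)
    have := norm_nonneg (M z₀)
    linarith
  · have h1 : ‖z - z₀‖ ≤ 1 / (4 * C) := by
      rw [← dist_eq_norm]; exact (Metric.ball_subset_ball (min_le_right _ _) hz).le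
    have h2 : ‖z₀ - w‖ ≤ 1 / (4 * C) := by
      rw [← dist_eq_norm, dist_comm]; exact (Metric.ball_subset_ball (min_le_right _ _) hw).le
    have h3 : ‖z - w‖ ≤ 1 / (4 * C) + 1 / (4 * C) := by
      rw [← sub_add_sub_cancel z z₀ w]; exact (norm_add_le _ _).trans (add_le_add h1 h2)
    calc C * ‖z - w‖ ≤ C * (1 / (4 * C) + 1 / (4 * C)) := by gcongr
      _ = 1 / 2 := by field_simp; norm_num

end Frobenius

/-! ### Continuation of local solutions over simply connected domains. -/

/-- Local solutions that are uniquely continuable extend over simply connected domains. -/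
theorem IsSimplyConnected.exists_forall_of_locally_existsUnique {X V : Type*} [TopologicalSpace X]
    [LocallyPathConnectedSpace X] {U : Set X} (hU : IsOpen U) (hsc : IsSimplyConnected U)
    (Sol : (X → V) → X → Prop)
    (congr : ∀ s s' x, s =ᶠ[nhds x] s' → Sol s x → Sol s' x)
    (loc : ∀ x ∈ U, ∃ W, IsOpen W ∧ x ∈ W ∧
      (∀ y ∈ W, ∀ v, ∃ s, s y = v ∧ ∀ z ∈ W, Sol s z) ∧
      ∀ s s', (∀ z ∈ W, Sol s z) → (∀ z ∈ W, Sol s' z) → ∀ y ∈ W, s y = s' y → Set.EqOn s s' W)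
    (uniq : ∀ x ∈ U, ∀ s s', (∀ᶠ z in nhds x, Sol s z) → (∀ᶠ z in nhds x, Sol s' z) →
      s x = s' x → s =ᶠ[nhds x] s')
    {x₀ : X} (hx₀ : x₀ ∈ U) (v₀ : V) :
    ∃ s, s x₀ = v₀ ∧ ∀ x ∈ U, Sol s x := by
  classical
  have : SimplyConnectedSpace U := hsc
  have : LocallyPathConnectedSpace U := hU.locallyPathConnectedSpace
  -- With discrete fibres the bundle of local solutions becomes a covering of U, and its continuous
  -- sections are the global solutions.
  let _ : TopologicalSpace V := ⊥
  have : DiscreteTopology V := ⟨rfl⟩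
  choose! W hWo hxW hWex hWuniq using loc
  -- the solution on `W i` with the value `v` at `i`
  have hΦ : ∀ (i : U) (v : V), ∃ s : X → V, s i = v ∧ ∀ z ∈ W i, Sol s z := fun i v =>
    hWex i i.2 i (hxW i i.2) v
  choose Φ hΦi hΦ using hΦ
  -- the value at `i` of the solution on `W i` with the value `v` at `x`
  have hΨ : ∀ (i : U) (x : X) (v : V), ∃ f : V, x ∈ W i → Φ i f x = v := by
    intro i x v
    by_cases hx : x ∈ W i
    · obtain ⟨s, hs, hsol⟩ := hWex i i.2 x hx v
      refine ⟨s i, fun _ => ?_⟩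
      rw [hWuniq i i.2 _ _ (hΦ i (s i)) hsol i (hxW i i.2) (hΦi i _) hx, hs]
    · exact ⟨v, fun h => absurd h hx⟩
  choose Ψ hΨ using hΨ
  have hinj : ∀ (i : U) (x : X), x ∈ W i → ∀ f f', Φ i f x = Φ i f' x → f = f' := by
    intro i x hx f f' h
    rw [← hΦi i f, ← hΦi i f']
    exact hWuniq i i.2 _ _ (hΦ i f) (hΦ i f') x hx h (hxW i i.2)
  -- In the trivialization i a local solution is labelled by the value at i of its extension to `W
  -- i`. As `indexAt` is the identity, the label of an element over x in its own fibre is the value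
  -- at x.
  let Z : FiberBundleCore U U V :=
    { baseSet := fun i => Subtype.val ⁻¹' W i
      isOpen_baseSet := fun i => (hWo i i.2).preimage continuous_subtype_val
      indexAt := id
      mem_baseSet_at := fun x => hxW x x.2
      coordChange := fun i j x v => Ψ j x (Φ i v x)
      coordChange_self := fun i x hx v => hinj i x hx _ _ (hΨ i x _ hx)
      continuousOn_coordChange := by
        rintro i j ⟨x, v⟩ ⟨⟨hi, hj⟩, -⟩
        -- The solutions on `W i` and `W j` that agree at x agree near x, so the transition between
        -- labels is locally constant.
        have key : ∀ᶠ y in nhds (x : X), Φ j (Ψ j x (Φ i v x)) y = Φ i v y :=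
          uniq x x.2 _ _ (Filter.Eventually.mono ((hWo j j.2).mem_nhds hj) fun z hz => hΦ j _ z hz)
            (Filter.Eventually.mono ((hWo i i.2).mem_nhds hi) fun z hz => hΦ i _ z hz) (hΨ j x _ hj)
        have key' : ∀ᶠ y : U in nhds x, Ψ j y (Φ i v y) = Ψ j x (Φ i v x) := by
          filter_upwards [continuous_subtype_val.continuousAt.eventually key,
            continuous_subtype_val.continuousAt.eventually ((hWo j j.2).mem_nhds hj)] with y hy hyj
          exact hinj j y hyj _ _ ((hΨ j y _ hyj).trans hy.symm)
        have : (fun p : U × V => Ψ j p.1 (Φ i p.2 p.1)) =ᶠ[nhds (x, v)]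
            fun _ => Ψ j x (Φ i v x) := by
          rw [nhds_prod_eq, nhds_discrete V]
          filter_upwards [key'.prod_mk (show ∀ᶠ w in pure v, w = v from rfl)] with p hp
          rw [hp.2, hp.1]
        exact (continuousAt_const.congr this.symm).continuousWithinAt
      coordChange_comp := by
        rintro i j k x ⟨⟨hi, hj⟩, hk⟩ v
        exact hinj k x hk _ _ (by rw [hΨ k x _ hk, hΨ k x _ hk, hΨ j x _ hj]) }
  have hcov : IsCoveringMap (Bundle.TotalSpace.proj : Z.TotalSpace → U) :=
    FiberBundle.isCoveringMap (F := V) (E := Z.Fiber)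
  -- Simple connectedness enters here: the identity of U lifts to a section of the covering through
  -- the prescribed value at x₀.
  obtain ⟨σ, ⟨hσ0, hσ⟩, -⟩ := hcov.existsUnique_continuousMap_lifts (ContinuousMap.id U)
    ⟨x₀, hx₀⟩ (⟨⟨x₀, hx₀⟩, v₀⟩ : Z.TotalSpace) rfl
  have hproj : ∀ x, (σ x).proj = x := fun x => congrFun hσ x
  let val : Z.TotalSpace → V := fun e => e.2
  refine ⟨fun x => if hx : x ∈ U then val (σ ⟨x, hx⟩) else v₀, ?_, fun x hx => ?_⟩
  · simp only [hx₀, dif_pos, hσ0, val]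
  · let i : U := ⟨x, hx⟩
    have hcont : ContinuousAt (fun y => (Z.localTriv i (σ y)).2) i := by
      refine ContinuousAt.comp (f := fun y => Z.localTriv i (σ y)) continuousAt_snd ?_
      refine ContinuousAt.comp ?_ σ.continuous.continuousAt
      refine (Z.localTriv i).continuousAt ?_
      rw [Z.mem_localTriv_source, hproj]
      exact hxW x hx
    have hloc : ∀ᶠ y in nhds i, (Z.localTriv i (σ y)).2 = (Z.localTriv i (σ i)).2 := by
      have := hcont.tendsto
      rw [nhds_discrete V, Filter.tendsto_pure] at this
      exact this
    set f := (Z.localTriv i (σ i)).2 with hf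
    have hval : ∀ y : U, (y : X) ∈ W i → (Z.localTriv i (σ y)).2 = f →
        Φ i f y = val (σ y) := by
      intro y hy h
      have e : (Z.localTriv i (σ y)).2 = Ψ i (σ y).proj (Φ (σ y).proj (val (σ y)) (σ y).proj) := rfl
      rw [hproj y] at e
      rw [← h, e, hΨ i y _ hy, hΦi]
    have hev : ∀ᶠ y in nhds x, Φ i f y =
        if hx : y ∈ U then val (σ ⟨y, hx⟩) else v₀ := by
      have h1 : ∀ᶠ y : U in nhds i, Φ i f y =
          if hx : (y : X) ∈ U then val (σ ⟨y, hx⟩) else v₀ := by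
        filter_upwards [hloc, continuous_subtype_val.continuousAt.eventually
          ((hWo i hx).mem_nhds (hxW i hx))] with y hy hyW
        rw [dif_pos y.2]
        exact hval y hyW hy
      have h2 := hU.isOpenEmbedding_subtypeVal.map_nhds_eq i
      have : ∀ᶠ y in Filter.map Subtype.val (nhds i), Φ i f y =
          if hx : y ∈ U then val (σ ⟨y, hx⟩) else v₀ := h1
      rwa [h2] at this
    exact congr _ _ _ hev (hΦ i f x (hxW x hx))

/-! ### Wirtinger calculus for real differentiable functions. -/

section Wirtinger

open ComplexConjugate

/-- `∂f/∂z̄ = ½ (∂f/∂x + i ∂f/∂y)`. -/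
noncomputable def dzb (f : ℂ → ℂ) (z : ℂ) : ℂ :=
  (fderiv ℝ f z 1 + I * fderiv ℝ f z I) / 2

/-- The real linear map `h ↦ p h + q h̄`. -/
noncomputable def wirtingerCLM (p q : ℂ) : ℂ →L[ℝ] ℂ :=
  p • ContinuousLinearMap.id ℝ ℂ + q • (conjCLE : ℂ →L[ℝ] ℂ)

@[simp]
lemma wirtingerCLM_apply (p q h : ℂ) : wirtingerCLM p q h = p * h + q * conj h := by
  simp [wirtingerCLM]

lemma eq_wirtingerCLM (L : ℂ →L[ℝ] ℂ) :
    L = wirtingerCLM ((L 1 - I * L I) / 2) ((L 1 + I * L I) / 2) := by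
  ext h
  have h1 : L h = h.re * L 1 + h.im * L I := by
    conv_lhs => rw [← re_add_im h]
    have e1 : ((h.re : ℂ)) = h.re • (1 : ℂ) := by simp
    have e2 : ((h.im : ℂ)) * I = h.im • I := by simp
    rw [e1, e2, map_add, map_smul, map_smul]
    simp
  rw [h1, wirtingerCLM_apply]
  have h2 : h = h.re + h.im * I := (re_add_im h).symm
  have h3 : conj h = h.re - h.im * I := by
    apply Complex.ext <;> simp
  rw [h3]
  nth_rewrite 3 [h2]
  linear_combination (h.im * L I) * I_sq

/-- `f` is real differentiable at `z` with `f_z = p` and `f_z̄ = q`. -/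
def HasWirtingerAt (f : ℂ → ℂ) (p q z : ℂ) : Prop := HasFDerivAt f (wirtingerCLM p q) z

namespace HasWirtingerAt

variable {f g : ℂ → ℂ} {p q p' q' z : ℂ}

lemma dz_eq (h : HasWirtingerAt f p q z) : dz f z = p := by
  rw [dz, HasFDerivAt.fderiv h]
  simp
  linear_combination (-p / 2 + q / 2) * I_sq

lemma dzb_eq (h : HasWirtingerAt f p q z) : dzb f z = q := by
  rw [dzb, HasFDerivAt.fderiv h]
  simp
  linear_combination (p / 2 - q / 2) * I_sq

lemma of_differentiableAt (h : DifferentiableAt ℝ f z) : HasWirtingerAt f (dz f z) (dzb f z) z := by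
  have := h.hasFDerivAt
  rw [eq_wirtingerCLM (fderiv ℝ f z)] at this
  exact this

lemma congr_wirtinger (h : HasWirtingerAt f p q z) (hp : p = p') (hq : q = q') :
    HasWirtingerAt f p' q' z := by
  subst hp hq; exact h

lemma congr_of_eventuallyEq (h : HasWirtingerAt f p q z) (hg : g =ᶠ[nhds z] f) :
    HasWirtingerAt g p q z :=
  HasFDerivAt.congr_of_eventuallyEq h hg

lemma const (c z : ℂ) : HasWirtingerAt (fun _ => c) 0 0 z := by
  have : wirtingerCLM 0 0 = 0 := by ext h; simp
  rw [HasWirtingerAt, this]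
  exact hasFDerivAt_const c z

lemma add (hf : HasWirtingerAt f p q z) (hg : HasWirtingerAt g p' q' z) :
    HasWirtingerAt (fun w => f w + g w) (p + p') (q + q') z := by
  refine (HasFDerivAt.add hf hg).congr_fderiv ?_
  ext h
  simp
  ring

lemma mul (hf : HasWirtingerAt f p q z) (hg : HasWirtingerAt g p' q' z) :
    HasWirtingerAt (fun w => f w * g w) (p * g z + f z * p') (q * g z + f z * q') z := by
  refine (HasFDerivAt.mul hf hg).congr_fderiv ?_
  ext h
  simp
  ring

lemma const_mul (c : ℂ) (hf : HasWirtingerAt f p q z) :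
    HasWirtingerAt (fun w => c * f w) (c * p) (c * q) z :=
  ((const c z).mul hf).congr_wirtinger (by ring) (by ring)

lemma conjugate (hf : HasWirtingerAt f p q z) :
    HasWirtingerAt (fun w => conj (f w)) (conj q) (conj p) z := by
  have := (conjCLE : ℂ →L[ℝ] ℂ).hasFDerivAt.comp z hf
  refine this.congr_fderiv ?_
  ext h
  simp
  ring

lemma inv (hf : HasWirtingerAt f p q z) (h0 : f z ≠ 0) :
    HasWirtingerAt (fun w => (f w)⁻¹) (-p / f z ^ 2) (-q / f z ^ 2) z := by
  have := ((hasDerivAt_inv h0).hasFDerivAt.restrictScalars ℝ).comp z hf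
  refine this.congr_fderiv ?_
  ext h
  simp
  ring

lemma div (hf : HasWirtingerAt f p q z) (hg : HasWirtingerAt g p' q' z) (h0 : g z ≠ 0) :
    HasWirtingerAt (fun w => f w / g w) ((p * g z - f z * p') / g z ^ 2)
      ((q * g z - f z * q') / g z ^ 2) z := by
  refine (hf.mul (hg.inv h0)).congr_wirtinger ?_ ?_ <;> field_simp <;> ring

lemma of_hasDerivAt {f' : ℂ} (hf : HasDerivAt f f' z) : HasWirtingerAt f f' 0 z := by
  refine (hf.hasFDerivAt.restrictScalars ℝ).congr_fderiv ?_
  ext h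
  simp [mul_comm]

lemma comp_hasDerivAt {h : ℂ → ℂ} {h' w : ℂ} (hf : HasWirtingerAt f p q (h w))
    (hh : HasDerivAt h h' w) :
    HasWirtingerAt (fun w => f (h w)) (p * h') (q * starRingEnd ℂ h') w := by
  have := HasFDerivAt.comp w hf (hh.hasFDerivAt.restrictScalars ℝ)
  refine this.congr_fderiv ?_
  ext k
  simp
  ring

lemma conj_eq_of_real {r : ℂ → ℝ} (h : HasWirtingerAt (fun w => (r w : ℂ)) p q z) :
    q = starRingEnd ℂ p := by
  have h2 := h.conjugate
  simp only [conj_ofReal] at h2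
  rw [← h.dzb_eq, h2.dzb_eq]

lemma of_real {r : ℂ → ℝ} (h : DifferentiableAt ℝ r z) :
    HasWirtingerAt (fun w => (r w : ℂ)) (dz (fun w => (r w : ℂ)) z)
      (starRingEnd ℂ (dz (fun w => (r w : ℂ)) z)) z := by
  have h1 := of_differentiableAt (f := fun w => (r w : ℂ))
    (ofRealCLM.differentiableAt.comp z h)
  exact h1.congr_wirtinger rfl h1.conj_eq_of_real

end HasWirtingerAt

lemma Filter.EventuallyEq.dz {f g : ℂ → ℂ} {z : ℂ} (h : f =ᶠ[nhds z] g) :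
    CubicIntegrals.dz f =ᶠ[nhds z] CubicIntegrals.dz g := by
  filter_upwards [h.fderiv (𝕜 := ℝ)] with w hw
  rw [CubicIntegrals.dz, CubicIntegrals.dz, hw]

lemma Filter.EventuallyEq.dzb {f g : ℂ → ℂ} {z : ℂ} (h : f =ᶠ[nhds z] g) :
    dzb f =ᶠ[nhds z] _root_.dzb g := by
  filter_upwards [h.fderiv (𝕜 := ℝ)] with w hw
  rw [_root_.dzb, _root_.dzb, hw]

lemma ContDiffAt.dz {f : ℂ → ℂ} {z : ℂ} (h : ContDiffAt ℝ ∞ f z) :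
    ContDiffAt ℝ ∞ (CubicIntegrals.dz f) z := by
  have := h.fderiv_right (m := ∞) le_rfl
  exact ((this.clm_apply contDiffAt_const).sub
    (contDiffAt_const.mul (this.clm_apply contDiffAt_const))).div_const 2

lemma fderiv_fderiv_apply {f : ℂ → ℂ} {z : ℂ} (h : ContDiffAt ℝ ∞ f z) (u v : ℂ) :
    fderiv ℝ (fun w => fderiv ℝ f w u) z v = fderiv ℝ (fderiv ℝ f) z v u := by
  have hd : DifferentiableAt ℝ (fderiv ℝ f) z :=
    (h.fderiv_right (m := ∞) le_rfl).differentiableAt (by simp)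
  have := hd.hasFDerivAt.clm_apply (hasFDerivAt_const u z)
  rw [this.fderiv]
  simp

/-- Symmetry of the second real derivative. All integrability conditions below are drawn from it. -/
lemma dz_dzb_comm {f : ℂ → ℂ} {z : ℂ} (h : ContDiffAt ℝ ∞ f z) :
    dz (dzb f) z = dzb (dz f) z := by
  have hs : IsSymmSndFDerivAt ℝ f z := h.isSymmSndFDerivAt
    (by simpa using WithTop.coe_le_coe.2 (le_top : (2 : ℕ∞) ≤ ⊤))
  have hd : ∀ u, DifferentiableAt ℝ (fun w => fderiv ℝ f w u) z := fun u =>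
    ((h.fderiv_right (m := ∞) le_rfl).clm_apply contDiffAt_const).differentiableAt (by simp)
  have e1 : ∀ v, fderiv ℝ (dzb f) z v =
      (fderiv ℝ (fderiv ℝ f) z v 1 + I * fderiv ℝ (fderiv ℝ f) z v I) / 2 := by
    intro v
    have := (((hd 1).hasFDerivAt.add ((hd I).hasFDerivAt.const_mul I)).mul_const (2⁻¹ : ℂ))
    have h2 : dzb f = fun w => (fderiv ℝ f w 1 + I * fderiv ℝ f w I) * 2⁻¹ := by
      ext w; rw [dzb, div_eq_mul_inv]
    rw [h2]
    refine (DFunLike.congr_fun (HasFDerivAt.fderiv this) v).trans ?_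
    simp [fderiv_fderiv_apply h]
    ring
  have e2 : ∀ v, fderiv ℝ (dz f) z v =
      (fderiv ℝ (fderiv ℝ f) z v 1 - I * fderiv ℝ (fderiv ℝ f) z v I) / 2 := by
    intro v
    have := (((hd 1).hasFDerivAt.sub ((hd I).hasFDerivAt.const_mul I)).mul_const (2⁻¹ : ℂ))
    have h2 : dz f = fun w => (fderiv ℝ f w 1 - I * fderiv ℝ f w I) * 2⁻¹ := by
      ext w; rw [dz, div_eq_mul_inv]
    rw [h2]
    refine (DFunLike.congr_fun (HasFDerivAt.fderiv this) v).trans ?_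
    simp [fderiv_fderiv_apply h]
    ring
  rw [dz, dzb, e1, e1, e2, e2, hs.eq 1 I]
  ring

end Wirtinger

/-- Bootstrapping: if u is n times continuously differentiable, so is its derivative M u. -/
lemma contDiffOn_of_hasFDerivAt_linear {X E : Type*} [NormedAddCommGroup X] [NormedSpace ℝ X]
    [NormedAddCommGroup E] [NormedSpace ℝ E] {s : Set X} (ho : IsOpen s)
    {M : X → E →L[ℝ] X →L[ℝ] E} (hM : ContDiffOn ℝ ∞ M s) {u : X → E}
    (hu : ∀ z ∈ s, HasFDerivAt u (M z (u z)) z) : ContDiffOn ℝ ∞ u s := by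
  rw [contDiffOn_infty]
  intro n
  induction n with
  | zero => exact contDiffOn_zero.2 fun z hz => (hu z hz).continuousAt.continuousWithinAt
  | succ n ih =>
    rw [Nat.cast_succ, contDiffOn_succ_iff_fderiv_of_isOpen ho]
    refine ⟨fun z hz => (hu z hz).differentiableAt.differentiableWithinAt,
      fun h => absurd h (by simp), ?_⟩
    exact ((hM.of_le (by exact_mod_cast le_top)).clm_apply ih).congr
      fun z hz => (hu z hz).fderiv

/-! ### The prolonged system for a vector field and its rotor. -/

section System

open ComplexConjugate

/-- The coefficients of the system `β_z = -ℓ β + i ρ / 2`, `β_z̄ = -Q` for a vector field `β` and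
its rotor `ρ` on a surface of constant curvature. -/
structure RotorCoefficients (O : Set ℂ) (ℓ Q R : ℂ → ℂ) (μ : ℂ → ℝ) : Prop where
  isOpen : IsOpen O
  smooth_ℓ : ∀ z ∈ O, ContDiffAt ℝ ∞ ℓ z
  smooth_Q : ∀ z ∈ O, ContDiffAt ℝ ∞ Q z
  smooth_R : ∀ z ∈ O, ContDiffAt ℝ ∞ R z
  smooth_μ : ∀ z ∈ O, ContDiffAt ℝ ∞ μ z
  dz_μ : ∀ z ∈ O, dz (fun w => (μ w : ℂ)) z = ℓ z * μ z
  dzb_ℓ : ∀ z ∈ O, dzb ℓ z = -μ z / 2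
  dz_Q : ∀ z ∈ O, dz Q z = R z / 8 - ℓ z * Q z

/-- `β_z = -ℓ β + i ρ / 2` and `β_z̄ = -Q` at the point `z`. -/
def IsRotorSolutionAt (ℓ Q : ℂ → ℂ) (β : ℂ → ℂ) (ρ : ℂ → ℝ) (z : ℂ) : Prop :=
  HasWirtingerAt β (-ℓ z * β z + I * ρ z / 2) (-Q z) z

variable {O : Set ℂ} {ℓ Q R : ℂ → ℂ} {μ : ℂ → ℝ}

/-- The prolonged linear system for `(β, ρ, 1)` at a point where the coefficients have the values
`l`, `q`, `r` and `m`. -/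
noncomputable def rotorSystem (l q r : ℂ) (m : ℝ) : (ℂ × ℝ × ℝ) →L[ℝ] ℂ →L[ℝ] (ℂ × ℝ × ℝ) :=
  LinearMap.toContinuousLinearMap
    { toFun := fun u => LinearMap.toContinuousLinearMap
        { toFun := fun h => ((-l * u.1 + I * u.2.1 / 2) * h - q * u.2.2 * conj h,
            (2 * (I * m * u.1 + I * r * u.2.2 / 4) * conj h).re, 0)
          map_add' := fun h k => by
            refine Prod.ext ?_ (Prod.ext ?_ ?_)
            · simp; ring
            · simp only [map_add, mul_add, add_re, Prod.mk_add_mk]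
            · simp
          map_smul' := fun c h => by
            refine Prod.ext ?_ (Prod.ext ?_ ?_)
            · simp; ring
            · simp; ring
            · simp }
      map_add' := fun u v => by
        ext1 h
        refine Prod.ext ?_ (Prod.ext ?_ ?_)
        · simp; ring
        · simp; ring
        · simp
      map_smul' := fun c u => by
        ext1 h
        refine Prod.ext ?_ (Prod.ext ?_ ?_)
        · simp; ring
        · simp; ring
        · simp }

lemma rotorSystem_apply (l q r : ℂ) (m : ℝ) (u : ℂ × ℝ × ℝ) (h : ℂ) :
    rotorSystem l q r m u h = ((-l * u.1 + I * u.2.1 / 2) * h - q * u.2.2 * conj h,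
      (2 * (I * m * u.1 + I * r * u.2.2 / 4) * conj h).re, 0) := rfl

namespace RotorCoefficients

lemma contDiffOn_rotorSystem (hc : RotorCoefficients O ℓ Q R μ) :
    ContDiffOn ℝ ∞ (fun z => rotorSystem (ℓ z) (Q z) (R z) (μ z)) O := by
  rw [contDiffOn_clm_apply]
  intro u
  rw [contDiffOn_clm_apply]
  intro h z hz
  refine ContDiffAt.contDiffWithinAt ?_
  simp only [rotorSystem_apply]
  have hl := hc.smooth_ℓ z hz
  have hq := hc.smooth_Q z hz
  have hr := hc.smooth_R z hz
  have hm : ContDiffAt ℝ ∞ (fun z => (μ z : ℂ)) z :=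
    ofRealCLM.contDiff.contDiffAt.comp z (hc.smooth_μ z hz)
  have h1 : ContDiffAt ℝ ∞
      (fun z => (-ℓ z * u.1 + I * u.2.1 / 2) * h - Q z * u.2.2 * conj h) z := by fun_prop
  have h2 : ContDiffAt ℝ ∞
      (fun z => 2 * (I * μ z * u.1 + I * R z * u.2.2 / 4) * conj h) z := by fun_prop
  exact h1.prodMk ((reCLM.contDiff.contDiffAt.comp z h2).prodMk contDiffAt_const)

lemma hasWirtingerAt_μ (hc : RotorCoefficients O ℓ Q R μ) {z : ℂ} (hz : z ∈ O) :
    HasWirtingerAt (fun w => (μ w : ℂ)) (ℓ z * μ z) (conj (ℓ z * μ z)) z := by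
  have := HasWirtingerAt.of_real ((hc.smooth_μ z hz).differentiableAt (by simp))
  rwa [hc.dz_μ z hz] at this

lemma hasWirtingerAt_ℓ (hc : RotorCoefficients O ℓ Q R μ) {z : ℂ} (hz : z ∈ O) :
    HasWirtingerAt ℓ (dz ℓ z) (-μ z / 2) z :=
  (HasWirtingerAt.of_differentiableAt
    ((hc.smooth_ℓ z hz).differentiableAt (by simp))).congr_wirtinger rfl (hc.dzb_ℓ z hz)

lemma hasWirtingerAt_Q (hc : RotorCoefficients O ℓ Q R μ) {z : ℂ} (hz : z ∈ O) :
    HasWirtingerAt Q (R z / 8 - ℓ z * Q z) (dzb Q z) z :=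
  (HasWirtingerAt.of_differentiableAt
    ((hc.smooth_Q z hz).differentiableAt (by simp))).congr_wirtinger (hc.dz_Q z hz) rfl

lemma hasWirtingerAt_R (hc : RotorCoefficients O ℓ Q R μ) {z : ℂ} (hz : z ∈ O) :
    HasWirtingerAt R (dz R z) (dzb R z) z :=
  HasWirtingerAt.of_differentiableAt ((hc.smooth_R z hz).differentiableAt (by simp))

/-- In the β-component the cross derivatives agree because of the formulas for ℓ_z̄ and Q_z. In the
ρ-component μ_z = ℓμ (constancy of the curvature) leaves only a multiple of Re R_z, which `hflat`
removes. -/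
lemma rotorSystem_flat (hc : RotorCoefficients O ℓ Q R μ)
    (hflat : ∀ z ∈ O, (dz R z).re = 0) {z : ℂ} (hz : z ∈ O) (h k : ℂ) (u : ℂ × ℝ × ℝ) :
    fderiv ℝ (fun z => rotorSystem (ℓ z) (Q z) (R z) (μ z)) z h u k
      + rotorSystem (ℓ z) (Q z) (R z) (μ z) (rotorSystem (ℓ z) (Q z) (R z) (μ z) u h) k
    = fderiv ℝ (fun z => rotorSystem (ℓ z) (Q z) (R z) (μ z)) z k u h
      + rotorSystem (ℓ z) (Q z) (R z) (μ z) (rotorSystem (ℓ z) (Q z) (R z) (μ z) u k) h := by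
  have hder : ∀ h k : ℂ, fderiv ℝ (fun z => rotorSystem (ℓ z) (Q z) (R z) (μ z)) z h u k =
      (-(dz ℓ z * h + -μ z / 2 * conj h) * u.1 * k
        - ((R z / 8 - ℓ z * Q z) * h + dzb Q z * conj h) * u.2.2 * conj k,
      (2 * (I * (ℓ z * μ z * h + conj (ℓ z * μ z) * conj h) * u.1
        + I * (dz R z * h + dzb R z * conj h) * u.2.2 / 4) * conj k).re, 0) := by
    intro h k
    have hd : HasFDerivAt (fun z => rotorSystem (ℓ z) (Q z) (R z) (μ z))
        (fderiv ℝ (fun z => rotorSystem (ℓ z) (Q z) (R z) (μ z)) z) z :=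
      ((hc.contDiffOn_rotorSystem.contDiffAt (hc.isOpen.mem_nhds hz)).differentiableAt
        (by simp)).hasFDerivAt
    have hd2 := (hd.clm_apply (hasFDerivAt_const u z)).clm_apply (hasFDerivAt_const k z)
    have g1 : HasWirtingerAt
        (fun z => (-ℓ z * u.1 + I * u.2.1 / 2) * k - Q z * u.2.2 * conj k)
        (-dz ℓ z * u.1 * k - (R z / 8 - ℓ z * Q z) * u.2.2 * conj k)
        (μ z / 2 * u.1 * k - dzb Q z * u.2.2 * conj k) z := by
      have e := (((hc.hasWirtingerAt_ℓ hz).const_mul (-(u.1 * k))).add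
        ((hc.hasWirtingerAt_Q hz).const_mul (-(u.2.2 * conj k)))).add
          (HasWirtingerAt.const (I * u.2.1 / 2 * k) z)
      refine (HasWirtingerAt.congr_wirtinger (e.congr_of_eventuallyEq (.of_forall fun w => ?_))
        ?_ ?_) <;> ring
    have g2 : HasWirtingerAt
        (fun z => 2 * (I * μ z * u.1 + I * R z * u.2.2 / 4) * conj k)
        (2 * (I * (ℓ z * μ z) * u.1 + I * dz R z * u.2.2 / 4) * conj k)
        (2 * (I * conj (ℓ z * μ z) * u.1 + I * dzb R z * u.2.2 / 4) * conj k) z := by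
      have e := ((hc.hasWirtingerAt_μ hz).const_mul (2 * I * u.1 * conj k)).add
        ((hc.hasWirtingerAt_R hz).const_mul (2 * I * u.2.2 / 4 * conj k))
      refine (HasWirtingerAt.congr_wirtinger (e.congr_of_eventuallyEq (.of_forall fun w => ?_))
        ?_ ?_) <;> ring
    have g := g1.prodMk ((reCLM.hasFDerivAt.comp z g2).prodMk (hasFDerivAt_const (0 : ℝ) z))
    have key := DFunLike.congr_fun (hd2.unique g) h
    have lhs : (fderiv ℝ (fun z => rotorSystem (ℓ z) (Q z) (R z) (μ z)) z h u k)
        = _ := Eq.trans (by simp) key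
    rw [lhs]
    refine Prod.ext ?_ (Prod.ext ?_ ?_)
    · simp only [ContinuousLinearMap.prod_apply, wirtingerCLM_apply]
      ring
    · simp only [ContinuousLinearMap.prod_apply, ContinuousLinearMap.comp_apply,
        wirtingerCLM_apply, reCLM_apply]
      congr 1
      ring
    · simp
  have hre : ∀ x : ℂ, ((x.re : ℝ) : ℂ) = (x + conj x) / 2 := fun x => by
    rw [add_conj]; push_cast; ring
  rw [hder, hder]
  simp only [rotorSystem_apply]
  refine Prod.ext ?_ (Prod.ext ?_ ?_)
  · simp only [Prod.mk_add_mk, hre]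
    simp only [map_add, map_mul, conj_conj, conj_I, conj_ofReal, map_div₀, map_ofNat, ofReal_zero]
    ring_nf
    simp only [I_sq]
    ring
  · have hR := hflat z hz
    simp only [Prod.mk_add_mk]
    simp only [add_re, mul_re, add_im, mul_im, sub_re, sub_im, neg_re, neg_im, conj_re, conj_im,
      I_re, I_im, ofReal_re, ofReal_im, div_ofNat_re, div_ofNat_im, re_ofNat, im_ofNat, hR]
    ring
  · simp

lemma exists_ball_isRotorSolutionAt (hc : RotorCoefficients O ℓ Q R μ)
    (hflat : ∀ z ∈ O, (dz R z).re = 0) {z₀ : ℂ} (hz₀ : z₀ ∈ O) :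
    ∃ r > 0, Metric.ball z₀ r ⊆ O ∧ ∀ y ∈ Metric.ball z₀ r, ∀ (β₀ : ℂ) (ρ₀ : ℝ),
      ∃ (β : ℂ → ℂ) (ρ : ℂ → ℝ), β y = β₀ ∧ ρ y = ρ₀ ∧ ContDiffOn ℝ ∞ β (Metric.ball z₀ r) ∧
        ∀ z ∈ Metric.ball z₀ r, IsRotorSolutionAt ℓ Q β ρ z := by
  obtain ⟨r, hr, hrO, hex⟩ := exists_ball_hasFDerivAt_linear hc.isOpen hc.contDiffOn_rotorSystem
    (fun z hz h k u => hc.rotorSystem_flat hflat hz h k u) hz₀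
  refine ⟨r, hr, hrO, fun y hy β₀ ρ₀ => ?_⟩
  obtain ⟨u, huy, hu⟩ := hex y hy (β₀, ρ₀, 1)
  have husm := contDiffOn_of_hasFDerivAt_linear Metric.isOpen_ball
    (hc.contDiffOn_rotorSystem.mono hrO) hu
  -- The third component has zero derivative and stays 1, so the homogeneous linear system carries
  -- the inhomogeneous terms Q and R.
  have hone : ∀ z ∈ Metric.ball z₀ r, (u z).2.2 = 1 := by
    intro z hz
    have hd : ∀ w ∈ Metric.ball z₀ r, HasFDerivAt (fun w => (u w).2.2) (0 : ℂ →L[ℝ] ℝ) w := by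
      intro w hw
      refine (hu w hw).snd.snd.congr_fderiv ?_
      ext1 k
      simp [rotorSystem_apply]
    have := (convex_ball z₀ r).is_const_of_fderivWithin_eq_zero (𝕜 := ℝ)
      (f := fun w => (u w).2.2)
      (fun w hw => (hd w hw).differentiableAt.differentiableWithinAt)
      (fun w hw => by
        rw [fderivWithin_of_isOpen Metric.isOpen_ball hw, (hd w hw).fderiv]) hz hy
    rw [this, huy]
  refine ⟨fun z => (u z).1, fun z => (u z).2.1, by simp [huy], by simp [huy], husm.fst,
    fun z hz => ?_⟩
  refine (hu z hz).fst.congr_fderiv ?_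
  ext1 h
  simp [rotorSystem_apply, hone z hz]
  ring

lemma _root_.IsRotorSolutionAt.rotor_eq {β : ℂ → ℂ} {ρ : ℂ → ℝ} {z : ℂ}
    (h : IsRotorSolutionAt ℓ Q β ρ z) : ρ z = 2 * (dz β z + ℓ z * β z).im := by
  rw [HasWirtingerAt.dz_eq h]
  simp
  ring

/-- The rotor is an expression in β and its derivative, hence smooth. Computing β_{zz̄} from both
equations and equating the results yields ρ_z̄; since ρ is real, ρ_z is its conjugate. -/
lemma hasWirtingerAt_rotor (hc : RotorCoefficients O ℓ Q R μ) {β : ℂ → ℂ} {ρ : ℂ → ℝ} {z : ℂ}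
    (hz : z ∈ O) (hβ : ContDiffAt ℝ ∞ β z)
    (h : ∀ᶠ w in nhds z, IsRotorSolutionAt ℓ Q β ρ w) :
    ContDiffAt ℝ ∞ ρ z ∧
    HasWirtingerAt (fun w => (ρ w : ℂ)) (conj (I * μ z * β z + I * R z / 4))
      (I * μ z * β z + I * R z / 4) z := by
  have hρ : ContDiffAt ℝ ∞ ρ z := by
    have : ContDiffAt ℝ ∞ (fun w => 2 * (dz β w + ℓ w * β w).im) z :=
      contDiffAt_const.mul (imCLM.contDiff.contDiffAt.comp z
        (hβ.dz.add ((hc.smooth_ℓ z hz).mul hβ)))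
    exact this.congr_of_eventuallyEq (h.mono fun w hw => hw.rotor_eq)
  refine ⟨hρ, ?_⟩
  have hw := HasWirtingerAt.of_real (hρ.differentiableAt (by simp))
  set p := dz (fun w => (ρ w : ℂ)) z
  have hβz : HasWirtingerAt β _ _ z := h.self_of_nhds
  have h1 : dz (dzb β) z = -(R z / 8 - ℓ z * Q z) := by
    have e : dzb β =ᶠ[nhds z] fun w => -1 * Q w :=
      h.mono fun w hw => (HasWirtingerAt.dzb_eq hw).trans (by ring)
    rw [e.dz.self_of_nhds, ((hc.hasWirtingerAt_Q hz).const_mul (-1)).dz_eq]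
    ring
  have h2 : dzb (dz β) z = μ z / 2 * β z + ℓ z * Q z + I / 2 * conj p := by
    have e : dz β =ᶠ[nhds z] fun w => -1 * (ℓ w * β w) + I / 2 * ρ w :=
      h.mono fun w hw => (HasWirtingerAt.dz_eq hw).trans (by ring)
    rw [e.dzb.self_of_nhds, ((((hc.hasWirtingerAt_ℓ hz).mul hβz).const_mul (-1)).add
      (hw.const_mul (I / 2))).dzb_eq]
    ring
  rw [dz_dzb_comm hβ, h2] at h1
  have h3 : conj p = I * μ z * β z + I * R z / 4 := by
    linear_combination (-2 * I) * h1 + conj p * I_sq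
  refine hw.congr_wirtinger ?_ h3
  rw [← h3, conj_conj]

/-- By `hasWirtingerAt_rotor` the triple (β, ρ, 1) solves the linear system, for which uniqueness is
known. -/
lemma eqOn_of_isRotorSolutionAt (hc : RotorCoefficients O ℓ Q R μ) {s : Set ℂ} (hs : Convex ℝ s)
    (ho : IsOpen s) (hsO : s ⊆ O) {β₁ β₂ : ℂ → ℂ} {ρ₁ ρ₂ : ℂ → ℝ}
    (hβ₁ : ContDiffOn ℝ ∞ β₁ s) (hβ₂ : ContDiffOn ℝ ∞ β₂ s)
    (h₁ : ∀ z ∈ s, IsRotorSolutionAt ℓ Q β₁ ρ₁ z) (h₂ : ∀ z ∈ s, IsRotorSolutionAt ℓ Q β₂ ρ₂ z)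
    {y : ℂ} (hy : y ∈ s) (hβ : β₁ y = β₂ y) (hρ : ρ₁ y = ρ₂ y) :
    Set.EqOn β₁ β₂ s ∧ Set.EqOn ρ₁ ρ₂ s := by
  have key : ∀ {β : ℂ → ℂ} {ρ : ℂ → ℝ}, ContDiffOn ℝ ∞ β s →
      (∀ z ∈ s, IsRotorSolutionAt ℓ Q β ρ z) → ∀ z ∈ s,
      HasFDerivAt (fun w => (β w, ρ w, (1 : ℝ)))
        (rotorSystem (ℓ z) (Q z) (R z) (μ z) (β z, ρ z, 1)) z := by
    intro β ρ hβ h z hz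
    have e := (hc.hasWirtingerAt_rotor (hsO hz) (hβ.contDiffAt (ho.mem_nhds hz))
      ((ho.eventually_mem hz).mono h)).2
    have e2 := reCLM.hasFDerivAt.comp z e
    have e3 := (h z hz).prodMk (e2.prodMk (hasFDerivAt_const (1 : ℝ) z))
    refine HasFDerivAt.congr_fderiv e3 ?_
    ext1 k
    refine Prod.ext ?_ (Prod.ext ?_ ?_)
    · simp [rotorSystem_apply]
      ring
    · have e4 : ∀ σ : ℂ, (conj σ * k + σ * conj k).re = (2 * σ * conj k).re := fun σ => by
        simp only [add_re, mul_re, mul_im, conj_re, conj_im, re_ofNat, im_ofNat]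
        ring
      simpa [rotorSystem_apply] using e4 (I * μ z * β z + I * R z / 4)
    · simp [rotorSystem_apply]
  have := eqOn_of_hasFDerivAt_linear hs (hc.contDiffOn_rotorSystem.continuousOn.mono hsO)
    (key hβ₁ h₁) (key hβ₂ h₂) hy (by simp [hβ, hρ])
  exact ⟨fun z hz => congrArg Prod.fst (this hz), fun z hz => congrArg (fun u => u.2.1) (this hz)⟩

/-- Necessity of the flatness condition: for real ρ the mixed derivative is real, while (iμβ +
iR/4)_z = -μρ/2 + iR_z/4 has imaginary part Re R_z/4. -/
lemma re_dz_R_eq_zero (hc : RotorCoefficients O ℓ Q R μ) {β : ℂ → ℂ} {ρ : ℂ → ℝ} {z : ℂ}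
    (hz : z ∈ O) (h : ∀ᶠ w in nhds z, ContDiffAt ℝ ∞ β w ∧ IsRotorSolutionAt ℓ Q β ρ w) :
    (dz R z).re = 0 := by
  have hev : ∀ᶠ w in nhds z, ContDiffAt ℝ ∞ ρ w ∧ HasWirtingerAt (fun w => (ρ w : ℂ))
      (conj (I * μ w * β w + I * R w / 4)) (I * μ w * β w + I * R w / 4) w := by
    filter_upwards [h.eventually_nhds, hc.isOpen.eventually_mem hz] with w hw hwO
    exact hc.hasWirtingerAt_rotor hwO hw.self_of_nhds.1 (hw.mono fun v hv => hv.2)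
  have hβz : HasWirtingerAt β _ _ z := h.self_of_nhds.2
  have hσ : HasWirtingerAt (fun w => I * μ w * β w + I * R w / 4)
      (-μ z * ρ z / 2 + I * dz R z / 4) _ z :=
    (HasWirtingerAt.congr_of_eventuallyEq
      ((((hc.hasWirtingerAt_μ hz).mul hβz).const_mul I).add
        ((hc.hasWirtingerAt_R hz).const_mul (I / 4))) (.of_forall fun w => by ring)).congr_wirtinger
      (by linear_combination (μ z * ρ z / 2) * I_sq) rfl
  have hcomm := dz_dzb_comm (f := fun w => (ρ w : ℂ)) (z := z)
    (ofRealCLM.contDiff.contDiffAt.comp z hev.self_of_nhds.1)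
  have e1 : dzb (fun w => (ρ w : ℂ)) =ᶠ[nhds z] fun w => I * μ w * β w + I * R w / 4 :=
    hev.mono fun w hw => hw.2.dzb_eq
  have e2 : dz (fun w => (ρ w : ℂ)) =ᶠ[nhds z] fun w => conj (I * μ w * β w + I * R w / 4) :=
    hev.mono fun w hw => hw.2.dz_eq
  rw [e1.dz.self_of_nhds, e2.dzb.self_of_nhds, hσ.dz_eq, hσ.conjugate.dzb_eq] at hcomm
  have := congrArg im hcomm
  simp only [conj_im, add_im, mul_im, div_ofNat_im, neg_im, ofReal_im, ofReal_re, I_re, I_im] at this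
  linarith

end RotorCoefficients

end System

/-! ### Coefficients of the system from an isothermic metric of constant curvature. -/

section Isothermic

open ComplexConjugate

lemma four_mul_dzb_dz {f : ℂ → ℂ} {z : ℂ} (h : ContDiffAt ℝ ∞ f z) :
    4 * dzb (dz f) z = Laplacian.laplacian f z := by
  have hs : IsSymmSndFDerivAt ℝ f z := h.isSymmSndFDerivAt
    (by simpa using WithTop.coe_le_coe.2 (le_top : (2 : ℕ∞) ≤ ⊤))
  have hd : ∀ u, DifferentiableAt ℝ (fun w => fderiv ℝ f w u) z := fun u =>
    ((h.fderiv_right (m := ∞) le_rfl).clm_apply contDiffAt_const).differentiableAt (by simp)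
  have e2 : ∀ v, fderiv ℝ (dz f) z v =
      (fderiv ℝ (fderiv ℝ f) z v 1 - I * fderiv ℝ (fderiv ℝ f) z v I) / 2 := by
    intro v
    have := (((hd 1).hasFDerivAt.sub ((hd I).hasFDerivAt.const_mul I)).mul_const (2⁻¹ : ℂ))
    have h2 : dz f = fun w => (fderiv ℝ f w 1 - I * fderiv ℝ f w I) * 2⁻¹ := by
      ext w; rw [dz, div_eq_mul_inv]
    rw [h2]
    refine (DFunLike.congr_fun (HasFDerivAt.fderiv this) v).trans ?_
    simp [fderiv_fderiv_apply h]
    ring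
  rw [dzb, e2, e2, hs.eq 1 I, InnerProductSpace.laplacian_eq_iteratedFDeriv_complexPlane]
  simp [iteratedFDeriv_two_apply]
  linear_combination (-fderiv ℝ (fderiv ℝ f) z I I) * I_sq

/-- `λ_z / λ`. -/
noncomputable def dzLog (lam : ℂ → ℝ) (z : ℂ) : ℂ := dz (fun w => (lam w : ℂ)) z / lam z

/-- The coefficient of the `(1,0)`-part of the covariant derivative of `f (∂/∂z)^{⊗k}`. -/
noncomputable def covDzOf (lam : ℂ → ℝ) (k : ℕ) (f : ℂ → ℂ) (z : ℂ) : ℂ :=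
  dz f z + k * dzLog lam z * f z

variable {O : Set ℂ} {lam : ℂ → ℝ} {f : ℂ → ℂ} {z : ℂ}

lemma contDiffAt_dzLog (hl : ContDiffAt ℝ ∞ lam z) (h0 : lam z ≠ 0) :
    ContDiffAt ℝ ∞ (dzLog lam) z := by
  have h1 : ContDiffAt ℝ ∞ (fun w => (lam w : ℂ)) z := ofRealCLM.contDiff.contDiffAt.comp z hl
  exact (h1.dz.mul (h1.inv (by exact_mod_cast h0))).congr_of_eventuallyEq
    (.of_forall fun w => div_eq_mul_inv _ _)

lemma contDiffAt_covDzOf (hl : ContDiffAt ℝ ∞ lam z) (h0 : lam z ≠ 0) (k : ℕ)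
    (hf : ContDiffAt ℝ ∞ f z) : ContDiffAt ℝ ∞ (covDzOf lam k f) z :=
  hf.dz.add ((contDiffAt_const.mul (contDiffAt_dzLog hl h0)).mul hf)

lemma hasWirtingerAt_conformal (hl : DifferentiableAt ℝ lam z) (h0 : lam z ≠ 0) :
    HasWirtingerAt (fun w => (lam w : ℂ)) (dzLog lam z * lam z) (conj (dzLog lam z) * lam z) z := by
  have h0' : (lam z : ℂ) ≠ 0 := by exact_mod_cast h0
  have e : dz (fun w => (lam w : ℂ)) z = dzLog lam z * lam z := by
    rw [dzLog, div_mul_cancel₀ _ h0']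
  refine (HasWirtingerAt.of_real hl).congr_wirtinger e ?_
  rw [e]
  simp

lemma dz_log_eq_dzLog (hl : DifferentiableAt ℝ lam z) (h0 : lam z ≠ 0) :
    dz (fun w => (Real.log (lam w) : ℂ)) z = dzLog lam z := by
  have h1 : ∀ v, fderiv ℝ (fun w => (Real.log (lam w) : ℂ)) z v =
      fderiv ℝ (fun w => (lam w : ℂ)) z v / lam z := by
    intro v
    have a := ofRealCLM.hasFDerivAt.comp z (hl.hasFDerivAt.log h0)
    have b := ofRealCLM.hasFDerivAt.comp z hl.hasFDerivAt
    rw [show fderiv ℝ (fun w => (Real.log (lam w) : ℂ)) z = _ from HasFDerivAt.fderiv a,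
      show fderiv ℝ (fun w => (lam w : ℂ)) z = _ from HasFDerivAt.fderiv b]
    simp
    ring
  rw [dzLog, dz, dz, h1, h1]
  ring

/-- As ℓ = (log λ)_z, its z̄-derivative is Δ(log λ)/4, which the curvature formula turns into -Kλ/2.
-/
lemma dzb_dzLog (hl : ∀ᶠ w in nhds z, ContDiffAt ℝ ∞ lam w ∧ lam w ≠ 0) {K : ℝ}
    (hK : -(Laplacian.laplacian (fun w : ℂ => Real.log (lam w)) z) / (2 * lam z) = K) :
    dzb (dzLog lam) z = -((K * lam z : ℝ) : ℂ) / 2 := by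
  obtain ⟨hz, h0⟩ := hl.self_of_nhds
  have e : dzLog lam =ᶠ[nhds z] dz (fun w => (Real.log (lam w) : ℂ)) :=
    hl.mono fun w hw => (dz_log_eq_dzLog (hw.1.differentiableAt (by simp)) hw.2).symm
  have hlog : ContDiffAt ℝ ∞ (fun w => Real.log (lam w)) z := hz.log h0
  have hlap : Laplacian.laplacian (fun w => (Real.log (lam w) : ℂ)) z
      = ((Laplacian.laplacian (fun w : ℂ => Real.log (lam w)) z : ℝ) : ℂ) :=
    (hlog.of_le (by simpa using WithTop.coe_le_coe.2 (le_top : (2 : ℕ∞) ≤ ⊤))).laplacian_CLM_comp_left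
      (l := ofRealCLM)
  have h4 := four_mul_dzb_dz (f := fun w => (Real.log (lam w) : ℂ)) (z := z)
    (ofRealCLM.contDiff.contDiffAt.comp z hlog)
  rw [e.dzb.self_of_nhds, ← hK]
  rw [hlap] at h4
  have h5 : dzb (dz (fun w => (Real.log (lam w) : ℂ))) z
      = ((Laplacian.laplacian (fun w : ℂ => Real.log (lam w)) z : ℝ) : ℂ) / 4 := by
    rw [← h4]; ring
  rw [h5]
  push_cast
  have h0' : (lam z : ℂ) ≠ 0 := by exact_mod_cast h0
  field_simp
  ring

/-- `λ A_{;z} / 8`. -/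
noncomputable def rotorQ (lam : ℂ → ℝ) (a : ℂ → ℂ) (z : ℂ) : ℂ := lam z * covDzOf lam 3 a z / 8

/-- `λ A_{;zz}`. -/
noncomputable def rotorR (lam : ℂ → ℝ) (a : ℂ → ℂ) (z : ℂ) : ℂ :=
  lam z * covDzOf lam 2 (covDzOf lam 3 a) z

/-- A positive conformal factor of constant curvature and a smooth coefficient on an open set. -/
structure IsothermicData (O : Set ℂ) (lam : ℂ → ℝ) (a : ℂ → ℂ) (K : ℝ) : Prop where
  isOpen : IsOpen O
  smooth : ContDiffOn ℝ ∞ lam O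
  pos : ∀ z ∈ O, 0 < lam z
  curvature : ∀ z ∈ O,
    -(Laplacian.laplacian (fun w : ℂ => Real.log (lam w)) z) / (2 * lam z) = K
  holomorphic : DifferentiableOn ℂ a O

namespace IsothermicData

variable {a : ℂ → ℂ} {K : ℝ}

lemma contDiffAt (hd : IsothermicData O lam a K) (hz : z ∈ O) : ContDiffAt ℝ ∞ lam z :=
  hd.smooth.contDiffAt (hd.isOpen.mem_nhds hz)

lemma ne_zero (hd : IsothermicData O lam a K) (hz : z ∈ O) : lam z ≠ 0 := (hd.pos z hz).ne'

lemma contDiffAt_coeff (hd : IsothermicData O lam a K) (hz : z ∈ O) : ContDiffAt ℝ ∞ a z :=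
  ((hd.holomorphic.analyticAt (hd.isOpen.mem_nhds hz)).contDiffAt (n := ∞)).restrict_scalars ℝ

lemma hasWirtingerAt_coeff (hd : IsothermicData O lam a K) (hz : z ∈ O) :
    HasWirtingerAt a (dz a z) 0 z := by
  have := HasWirtingerAt.of_hasDerivAt
    ((hd.holomorphic.differentiableAt (hd.isOpen.mem_nhds hz)).hasDerivAt)
  rwa [← this.dz_eq] at this

lemma hasWirtingerAt_conformal (hd : IsothermicData O lam a K) (hz : z ∈ O) :
    HasWirtingerAt (fun w => (lam w : ℂ)) (dzLog lam z * lam z) (conj (dzLog lam z) * lam z) z :=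
  _root_.hasWirtingerAt_conformal ((hd.contDiffAt hz).differentiableAt (by simp)) (hd.ne_zero hz)

lemma rotorCoefficients (hd : IsothermicData O lam a K) :
    RotorCoefficients O (dzLog lam) (rotorQ lam a) (rotorR lam a) (fun z => K * lam z) := by
  have hlam : ∀ z ∈ O, ContDiffAt ℝ ∞ (fun w => (lam w : ℂ)) z := fun z hz =>
    ofRealCLM.contDiff.contDiffAt.comp z (hd.contDiffAt hz)
  have h1 : ∀ z ∈ O, ContDiffAt ℝ ∞ (covDzOf lam 3 a) z := fun z hz =>
    contDiffAt_covDzOf (hd.contDiffAt hz) (hd.ne_zero hz) 3 (hd.contDiffAt_coeff hz)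
  refine ⟨hd.isOpen, fun z hz => contDiffAt_dzLog (hd.contDiffAt hz) (hd.ne_zero hz),
    fun z hz => ((hlam z hz).mul (h1 z hz)).div_const 8,
    fun z hz => (hlam z hz).mul
      (contDiffAt_covDzOf (hd.contDiffAt hz) (hd.ne_zero hz) 2 (h1 z hz)),
    fun z hz => contDiffAt_const.mul (hd.contDiffAt hz), fun z hz => ?_, fun z hz => ?_,
    fun z hz => ?_⟩
  · have := (hd.hasWirtingerAt_conformal hz).const_mul (K : ℂ)
    push_cast
    rw [this.dz_eq]
    ring
  · exact dzb_dzLog ((hd.isOpen.eventually_mem hz).mono fun w hw =>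
      ⟨hd.contDiffAt hw, hd.ne_zero hw⟩) (hd.curvature z hz)
  · have e := ((hd.hasWirtingerAt_conformal hz).mul (HasWirtingerAt.of_differentiableAt
      ((h1 z hz).differentiableAt (by simp)))).const_mul (8⁻¹)
    have e2 : rotorQ lam a = fun w => 8⁻¹ * (lam w * covDzOf lam 3 a w) := by
      ext w; rw [rotorQ]; ring
    have e3 : covDzOf lam 2 (covDzOf lam 3 a) z
        = dz (covDzOf lam 3 a) z + 2 * dzLog lam z * covDzOf lam 3 a z := by
      conv_lhs => rw [covDzOf]
      push_cast
      rfl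
    rw [e2, e.dz_eq, rotorR, e3]
    ring

/-- A factor λ absorbs one Christoffel term: (λf)_z = λ(f_z + ℓf). So R_z is λA_{;zzz}, and the
flatness condition becomes D₀ = 0. -/
lemma dz_rotorR (hd : IsothermicData O lam a K) (hz : z ∈ O) :
    dz (rotorR lam a) z = lam z * covDzOf lam 1 (covDzOf lam 2 (covDzOf lam 3 a)) z := by
  have h2 : ContDiffAt ℝ ∞ (covDzOf lam 2 (covDzOf lam 3 a)) z :=
    contDiffAt_covDzOf (hd.contDiffAt hz) (hd.ne_zero hz) 2
      (contDiffAt_covDzOf (hd.contDiffAt hz) (hd.ne_zero hz) 3 (hd.contDiffAt_coeff hz))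
  have e := (hd.hasWirtingerAt_conformal hz).mul (HasWirtingerAt.of_differentiableAt
      (h2.differentiableAt (by simp)))
  rw [show rotorR lam a = _ from rfl]
  refine e.dz_eq.trans ?_
  conv_rhs => rw [covDzOf]
  push_cast
  ring

lemma re_dz_rotorR_eq_zero_iff (hd : IsothermicData O lam a K) (hz : z ∈ O) :
    (dz (rotorR lam a) z).re = 0 ↔
      4 * (covDzOf lam 1 (covDzOf lam 2 (covDzOf lam 3 a)) z).re = 0 := by
  rw [hd.dz_rotorR hz, re_ofReal_mul]
  have := hd.ne_zero hz
  simp [this]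

end IsothermicData

end Isothermic

/-! ### The Poisson bracket of the Hamiltonian with a cubic form. -/

section PoissonBracket

open ComplexConjugate

lemma hasDerivAt_complexMomentum_fst (px py : ℝ) :
    HasDerivAt (fun s : ℝ => complexMomentum s py) (1 / 2) px := by
  have := ((HasDerivAt.ofReal_comp (hasDerivAt_id px)).sub_const (I * (py : ℂ))).div_const 2
  simpa [complexMomentum] using this

lemma hasDerivAt_complexMomentum_snd (px py : ℝ) :
    HasDerivAt (fun s : ℝ => complexMomentum px s) (-I / 2) py := by
  have := (((HasDerivAt.ofReal_comp (hasDerivAt_id py)).const_mul I).const_sub (px : ℂ)).div_const 2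
  simpa [complexMomentum] using this

lemma hasDerivAt_cubic {m : ℝ → ℂ} {m' : ℂ} {t : ℝ} (hm : HasDerivAt m m' t) (a b : ℂ) :
    HasDerivAt (fun s => (a * m s ^ 3 + b * m s ^ 2 * star (m s)).re)
      (a * (3 * m t ^ 2 * m') + b * (2 * m t * m' * conj (m t) + m t ^ 2 * conj m')).re t := by
  have h := ((hm.pow 3).const_mul a).add (((hm.pow 2).const_mul b).mul hm.star)
  have h2 := reCLM.hasFDerivAt.comp_hasDerivAt t h
  refine h2.congr_deriv ?_
  simp only [reCLM_apply, Pi.pow_apply]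
  congr 1
  simp
  ring

/-- The Poisson bracket of the Hamiltonian `(p_x² + p_y²) / (2 λ)` with the cubic form
`Re (a p³ + b p² p̄)`. -/
lemma poissonBracket_cubic {lam : ℂ → ℝ} {a b : ℂ → ℂ} {z l a' bz bzb : ℂ}
    {H F : ℂ → ℝ → ℝ → ℝ} (h0 : lam z ≠ 0)
    (hl : HasWirtingerAt (fun w => (lam w : ℂ)) (l * lam z) (conj l * lam z) z)
    (ha : HasWirtingerAt a a' 0 z) (hb : HasWirtingerAt b bz bzb z)
    (hH : ∀ w px py, H w px py = (px ^ 2 + py ^ 2) / (2 * lam w))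
    (hF : ∀ᶠ w in nhds z, ∀ px py, F w px py =
      (a w * complexMomentum px py ^ 3
        + b w * complexMomentum px py ^ 2 * star (complexMomentum px py)).re) (px py : ℝ) :
    poissonBracket H F z px py = 2 / lam z *
      (complexMomentum px py ^ 3 * conj (complexMomentum px py)
          * (a' + 3 * l * a z + bzb + conj l * b z)
        + complexMomentum px py ^ 2 * conj (complexMomentum px py) ^ 2
          * (bz + 2 * l * b z)).re := by
  have hlr : HasFDerivAt lam (reCLM.comp (wirtingerCLM (l * lam z) (conj l * lam z))) z :=
    reCLM.hasFDerivAt.comp z hl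
  have hHx : deriv (fun s => H z s py) px = px / lam z := by
    have : HasDerivAt (fun s : ℝ => (s ^ 2 + py ^ 2) / (2 * lam z)) (px / lam z) px := by
      refine ((((hasDerivAt_id px).pow 2).add_const (py ^ 2)).div_const (2 * lam z)).congr_deriv ?_
      simp
      field_simp
    simp only [hH]
    exact this.deriv
  have hHy : deriv (fun s => H z px s) py = py / lam z := by
    have : HasDerivAt (fun s : ℝ => (px ^ 2 + s ^ 2) / (2 * lam z)) (py / lam z) py := by
      refine ((((hasDerivAt_id py).pow 2).const_add (px ^ 2)).div_const (2 * lam z)).congr_deriv ?_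
      simp
      field_simp
    simp only [hH]
    exact this.deriv
  have hHz : ∀ v, fderiv ℝ (fun w => H w px py) z v =
      -((px ^ 2 + py ^ 2) / 2) * (2 * (l * v).re) / lam z := by
    intro v
    have h1 := (((hasDerivAt_inv h0).comp_hasFDerivAt z hlr)).const_mul ((px ^ 2 + py ^ 2) / 2)
    have h2 : (fun w => H w px py) = fun w => (px ^ 2 + py ^ 2) / 2 * (lam w)⁻¹ := by
      ext w; rw [hH, div_mul_eq_div_div, div_eq_mul_inv]
    rw [h2]
    refine (DFunLike.congr_fun (HasFDerivAt.fderiv h1) v).trans ?_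
    simp
    field_simp
    ring
  set p := complexMomentum px py with hp
  have hFz : ∀ v, fderiv ℝ (fun w => F w px py) z v =
      (a' * v * p ^ 3 + (bz * v + bzb * conj v) * p ^ 2 * conj p).re := by
    intro v
    have h1 : HasWirtingerAt (fun w => a w * p ^ 3 + b w * p ^ 2 * star p) (a' * p ^ 3
        + bz * p ^ 2 * conj p) (bzb * p ^ 2 * conj p) z :=
      (((ha.mul (.const (p ^ 3) z)).add ((hb.mul (.const (p ^ 2) z)).mul
        (.const (star p) z)))).congr_wirtinger (by simp) (by simp)
    have h2 := reCLM.hasFDerivAt.comp z h1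
    have h3 : (fun w => F w px py) =ᶠ[nhds z] reCLM ∘
        fun w => a w * p ^ 3 + b w * p ^ 2 * star p := hF.mono fun w hw => hw px py
    rw [h3.fderiv_eq, h2.fderiv]
    simp only [ContinuousLinearMap.comp_apply, wirtingerCLM_apply, reCLM_apply]
    congr 1
    ring
  have hFx : deriv (fun s => F z s py) px = (a z * (3 * p ^ 2 * (1 / 2))
      + b z * (2 * p * (1 / 2) * conj p + p ^ 2 * conj (1 / 2))).re := by
    simp only [hF.self_of_nhds]
    exact (hasDerivAt_cubic (hasDerivAt_complexMomentum_fst px py) (a z) (b z)).deriv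
  have hFy : deriv (fun s => F z px s) py = (a z * (3 * p ^ 2 * (-I / 2))
      + b z * (2 * p * (-I / 2) * conj p + p ^ 2 * conj (-I / 2))).re := by
    simp only [hF.self_of_nhds]
    exact (hasDerivAt_cubic (hasDerivAt_complexMomentum_snd px py) (a z) (b z)).deriv
  rw [poissonBracket, hHx, hHy, hHz, hHz, hFz, hFz, hFx, hFy]
  have hpre : p.re = px / 2 := by simp [hp, complexMomentum]
  have hpim : p.im = -py / 2 := by simp [hp, complexMomentum]
  have hpx : px = 2 * p.re := by rw [hpre]; ring
  have hpy : py = -2 * p.im := by rw [hpim]; ring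
  -- Everything is expressed through the real and imaginary parts of p, which is then made opaque; a
  -- polynomial identity in real variables is left.
  rw [hpx, hpy]
  clear_value p
  clear hpre hpim hpx hpy hp hFx hFy hFz hHz hHx hHy
  simp only [pow_succ, pow_zero, one_mul, add_re, mul_re, add_im, mul_im, neg_re, neg_im, conj_re,
    conj_im, I_re, I_im, div_ofNat_re, div_ofNat_im, re_ofNat, im_ofNat, one_re, one_im]
  field_simp
  ring

/-- `{H, Re (a p³ + b p² p̄)} = 0` in terms of the coefficients. -/
lemma forall_re_quartic_eq_zero_iff {E₁ E₂ : ℂ} :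
    (∀ px py : ℝ, (complexMomentum px py ^ 3 * conj (complexMomentum px py) * E₁
        + complexMomentum px py ^ 2 * conj (complexMomentum px py) ^ 2 * E₂).re = 0) ↔
      E₁ = 0 ∧ E₂.re = 0 := by
  constructor
  · intro h
    -- At these three covectors p² is 1/4, -1/4 and -i/2. The first two separate Re E₁ from Re E₂,
    -- and the third gives Im E₁.
    have h1 := h 1 0
    have h2 := h 0 1
    have h3 := h 1 1
    simp only [complexMomentum, pow_succ, pow_zero, one_mul, add_re, mul_re, mul_im,
      sub_re, sub_im, conj_re, conj_im, I_re, I_im, ofReal_re, ofReal_im, div_ofNat_re,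
      div_ofNat_im] at h1 h2 h3
    ring_nf at h1 h2 h3
    refine ⟨Complex.ext ?_ ?_, ?_⟩
    · simp; linarith
    · simp; linarith
    · linarith
  · rintro ⟨rfl, h⟩ px py
    set p := complexMomentum px py
    have : p ^ 2 * conj p ^ 2 = ((normSq p ^ 2 : ℝ) : ℂ) := by
      rw [← mul_pow, mul_conj]; push_cast; rfl
    rw [mul_zero, zero_add, this, re_ofReal_mul, h, mul_zero]

/-- The cubic form `Re (a p³ + (8 β / λ) p² p̄)` is an integral if and only if `β` solves the
rotor system. -/
lemma IsothermicData.poissonBracket_eq_zero_iff {O : Set ℂ} {lam : ℂ → ℝ} {a : ℂ → ℂ} {K : ℝ}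
    (hd : IsothermicData O lam a K) {z : ℂ} (hz : z ∈ O) {β : ℂ → ℂ} (hβ : DifferentiableAt ℝ β z)
    {H F : ℂ → ℝ → ℝ → ℝ} (hH : ∀ w px py, H w px py = (px ^ 2 + py ^ 2) / (2 * lam w))
    (hF : ∀ᶠ w in nhds z, ∀ px py, F w px py =
      (a w * complexMomentum px py ^ 3 + 8 * β w / lam w * complexMomentum px py ^ 2
        * star (complexMomentum px py)).re) :
    (∀ px py, poissonBracket H F z px py = 0) ↔
      dzb β z = -rotorQ lam a z ∧ (dz β z + dzLog lam z * β z).re = 0 := by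
  have h0 := hd.ne_zero hz
  have h0' : (lam z : ℂ) ≠ 0 := by exact_mod_cast h0
  have hl := hd.hasWirtingerAt_conformal hz
  have hβ' := HasWirtingerAt.of_differentiableAt hβ
  have hb : HasWirtingerAt (fun w => 8 * β w / lam w)
      (8 / lam z * (dz β z - dzLog lam z * β z)) 
      (8 / lam z * (dzb β z - conj (dzLog lam z) * β z)) z := by
    refine ((hβ'.const_mul 8).div hl h0').congr_wirtinger ?_ ?_ <;> field_simp
  have key := poissonBracket_cubic h0 hl (hd.hasWirtingerAt_coeff hz) hb hH hF
  have hpos : 2 / lam z ≠ 0 := by positivity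
  simp only [key, mul_eq_zero, hpos, false_or]
  rw [forall_re_quartic_eq_zero_iff]
  have e1 : dz a z + 3 * dzLog lam z * a z + 8 / lam z * (dzb β z - conj (dzLog lam z) * β z)
      + conj (dzLog lam z) * (8 * β z / lam z) = 8 / lam z * (dzb β z + rotorQ lam a z) := by
    rw [rotorQ, covDzOf]
    push_cast
    field_simp
    ring
  have e2 : 8 / lam z * (dz β z - dzLog lam z * β z) + 2 * dzLog lam z * (8 * β z / lam z)
      = ((8 / lam z : ℝ) : ℂ) * (dz β z + dzLog lam z * β z) := by
    push_cast
    field_simp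
    ring
  rw [e1, e2, re_ofReal_mul, mul_eq_zero, mul_eq_zero, eq_neg_iff_add_eq_zero]
  have h8 : (8 : ℂ) / lam z ≠ 0 := div_ne_zero (by norm_num) h0'
  have h8' : (8 : ℝ) / lam z ≠ 0 := by positivity
  simp only [h8, h8', false_or]

/-- For this choice of ρ the equation for β_z prescribes only the real part of β_z + ℓβ, its
imaginary part being matched by definition. -/
lemma isRotorSolutionAt_iff {ℓ Q β : ℂ → ℂ} {z : ℂ} (hβ : DifferentiableAt ℝ β z) :
    IsRotorSolutionAt ℓ Q β (fun w => 2 * (dz β w + ℓ w * β w).im) z ↔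
      dzb β z = -Q z ∧ (dz β z + ℓ z * β z).re = 0 := by
  have hβ' := HasWirtingerAt.of_differentiableAt hβ
  constructor
  · intro h
    refine ⟨HasWirtingerAt.dzb_eq h, ?_⟩
    rw [HasWirtingerAt.dz_eq h]
    simp
  · rintro ⟨h1, h2⟩
    refine hβ'.congr_wirtinger ?_ h1
    have : dz β z + ℓ z * β z = I * ((dz β z + ℓ z * β z).im : ℂ) := by
      apply Complex.ext <;> simp [h2]
    push_cast
    linear_combination this

end PoissonBracket

/-! ### Holomorphic transition maps and transformation laws. -/

section Charts

open ComplexConjugate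

variable {S : Type*} [TopologicalSpace S] [ChartedSpace ℂ S]

lemma isOpen_chartImage (φ : OpenPartialHomeomorph S ℂ) {U : Set S} (hU : IsOpen U) :
    IsOpen (chartImage φ U) := φ.isOpen_inter_preimage_symm hU

section Transition

variable [IsManifold 𝓘(ℂ) ω S] {φ ψ χ : OpenPartialHomeomorph S ℂ}

lemma contDiffAt_transition (hφ : φ ∈ atlas ℂ S) (hψ : ψ ∈ atlas ℂ S) {z : ℂ}
    (hz : z ∈ φ.target) (hz' : φ.symm z ∈ ψ.source) : ContDiffAt ℂ ω (ψ ∘ φ.symm) z := by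
  have h1 := (contMDiffOn_symm_of_mem_maximalAtlas
    (IsManifold.subset_maximalAtlas (I := 𝓘(ℂ)) (n := ω) hφ)).contMDiffAt (φ.open_target.mem_nhds hz)
  have h2 := (contMDiffOn_of_mem_maximalAtlas
    (IsManifold.subset_maximalAtlas (I := 𝓘(ℂ)) (n := ω) hψ)).contMDiffAt
    (ψ.open_source.mem_nhds hz')
  exact (h2.comp z h1).contDiffAt

lemma hasDerivAt_transition (hφ : φ ∈ atlas ℂ S) (hψ : ψ ∈ atlas ℂ S) {z : ℂ}
    (hz : z ∈ φ.target) (hz' : φ.symm z ∈ ψ.source) :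
    HasDerivAt (ψ ∘ φ.symm) (deriv (ψ ∘ φ.symm) z) z :=
  ((contDiffAt_transition hφ hψ hz hz').differentiableAt (by simp)).hasDerivAt

lemma eventually_mem_transition {z : ℂ} (hz : z ∈ φ.target) (hz' : φ.symm z ∈ ψ.source) :
    ∀ᶠ w in nhds z, w ∈ φ.target ∧ φ.symm w ∈ ψ.source :=
  (φ.open_target.eventually_mem hz).and
    ((φ.continuousAt_symm hz).eventually (ψ.open_source.eventually_mem hz'))

lemma deriv_transition_mul (hφ : φ ∈ atlas ℂ S) (hψ : ψ ∈ atlas ℂ S) (hχ : χ ∈ atlas ℂ S) {z : ℂ}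
    (hz : z ∈ φ.target) (hz' : φ.symm z ∈ ψ.source) (hz'' : φ.symm z ∈ χ.source) :
    deriv (χ ∘ φ.symm) z =
      deriv (χ ∘ ψ.symm) (ψ (φ.symm z)) * deriv (ψ ∘ φ.symm) z := by
  have h1 := hasDerivAt_transition hφ hψ hz hz'
  have h2 := hasDerivAt_transition hψ hχ (ψ.map_source hz') (by rwa [ψ.left_inv hz'])
  have h3 := HasDerivAt.comp z h2 h1
  rw [← h3.deriv]
  refine Filter.EventuallyEq.deriv_eq ?_
  filter_upwards [eventually_mem_transition hz hz'] with w hw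
  simp [ψ.left_inv hw.2]

lemma deriv_transition_self {z : ℂ} (hz : z ∈ φ.target) : deriv (φ ∘ φ.symm) z = 1 := by
  have : φ ∘ φ.symm =ᶠ[nhds z] id := by
    filter_upwards [φ.open_target.eventually_mem hz] with w hw
    simp [φ.right_inv hw]
  rw [this.deriv_eq, deriv_id]

lemma deriv_transition_ne_zero (hφ : φ ∈ atlas ℂ S) (hψ : ψ ∈ atlas ℂ S) {z : ℂ}
    (hz : z ∈ φ.target) (hz' : φ.symm z ∈ ψ.source) : deriv (ψ ∘ φ.symm) z ≠ 0 := by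
  have h := deriv_transition_mul hφ hψ hφ hz hz' (φ.map_target hz)
  rw [deriv_transition_self hz] at h
  exact right_ne_zero_of_mul (h ▸ one_ne_zero)

end Transition

variable [IsManifold 𝓘(ℝ, ℂ) ∞ S] [IsManifold 𝓘(ℂ) ω S] {φ ψ : OpenPartialHomeomorph S ℂ}

/-- A tangent vector at p is by definition a complex number read in the preferred chart at p, so dφ
is multiplication by the complex derivative of the transition map. -/
lemma chartDeriv_apply (hφ : φ ∈ atlas ℂ S) {p : S} (hp : p ∈ φ.source)
    (v : TangentSpace 𝓘(ℝ, ℂ) p) :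
    chartDeriv φ p v = deriv (φ ∘ (chartAt ℂ p).symm) (chartAt ℂ p p) * (show ℂ from v) := by
  have hm : MDifferentiableAt 𝓘(ℝ, ℂ) 𝓘(ℝ, ℂ) φ p := mdifferentiableAt_atlas hφ hp
  have h := hasDerivAt_transition (chart_mem_atlas ℂ p) hφ (mem_chart_target ℂ p)
    (by rwa [(chartAt ℂ p).left_inv (mem_chart_source ℂ p)])
  have h2 := (h.hasFDerivAt.restrictScalars ℝ).fderiv
  refine (DFunLike.congr_fun hm.mfderiv v).trans ?_
  simp only [writtenInExtChartAt, mfld_simps, fderivWithin_univ]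
  have h3 : fderiv ℝ (φ ∘ (chartAt ℂ p).symm) (chartAt ℂ p p) (show ℂ from v) = _ :=
    DFunLike.congr_fun h2 (show ℂ from v)
  exact h3.trans (mul_comm (show ℂ from v) _)

lemma chartSymmDeriv_apply (hφ : φ ∈ atlas ℂ S) {z : ℂ} (hz : z ∈ φ.target) (v : ℂ) :
    chartSymmDeriv φ z v = deriv (chartAt ℂ (φ.symm z) ∘ φ.symm) z * v := by
  have hm : MDifferentiableAt 𝓘(ℝ, ℂ) 𝓘(ℝ, ℂ) φ.symm z := mdifferentiableAt_atlas_symm hφ hz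
  have h := hasDerivAt_transition hφ (chart_mem_atlas ℂ (φ.symm z)) hz (mem_chart_source ℂ _)
  have h2 := (h.hasFDerivAt.restrictScalars ℝ).fderiv
  refine (DFunLike.congr_fun hm.mfderiv v).trans ?_
  simp only [writtenInExtChartAt, mfld_simps, fderivWithin_univ]
  have h3 : fderiv ℝ (chartAt ℂ (φ.symm z) ∘ φ.symm) z v = _ := DFunLike.congr_fun h2 v
  refine h3.trans ?_
  simp [mul_comm]

lemma chartDeriv_transition (hφ : φ ∈ atlas ℂ S) (hψ : ψ ∈ atlas ℂ S) {p : S}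
    (hp : p ∈ φ.source) (hp' : p ∈ ψ.source) (v : TangentSpace 𝓘(ℝ, ℂ) p) :
    chartDeriv ψ p v = deriv (ψ ∘ φ.symm) (φ p) * chartDeriv φ p v := by
  have e := (chartAt ℂ p).left_inv (mem_chart_source ℂ p)
  rw [chartDeriv_apply hφ hp, chartDeriv_apply hψ hp', ← mul_assoc,
    deriv_transition_mul (chart_mem_atlas ℂ p) hφ hψ (mem_chart_target ℂ p) (by rwa [e])
      (by rwa [e]), e]

lemma chartDeriv_chartSymmDeriv (hφ : φ ∈ atlas ℂ S) (hψ : ψ ∈ atlas ℂ S) {z : ℂ}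
    (hz : z ∈ φ.target) (hz' : φ.symm z ∈ ψ.source) (v : ℂ) :
    chartDeriv ψ (φ.symm z) (chartSymmDeriv φ z v) = deriv (ψ ∘ φ.symm) z * v := by
  rw [chartDeriv_apply hψ hz', chartSymmDeriv_apply hφ hz,
    deriv_transition_mul hφ (chart_mem_atlas ℂ (φ.symm z)) hψ hz (mem_chart_source ℂ _) hz',
    mul_assoc]

/-- The factor is the smooth metric evaluated on the coordinate field ∂/∂x, which is smooth as the
image of a constant field under the tangent map of the inverse chart. -/
lemma contDiffOn_conformalFactor (g : Metric S) (hφ : φ ∈ atlas ℂ S) :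
    ContDiffOn ℝ ∞ (conformalFactor g φ) φ.target := by
  have hs : ContMDiffOn 𝓘(ℝ, ℂ) 𝓘(ℝ, ℂ) ∞ φ.symm φ.target := contMDiffOn_symm_of_mem_maximalAtlas
    (IsManifold.subset_maximalAtlas (I := 𝓘(ℝ, ℂ)) (n := ∞) hφ)
  have hv : ContMDiffOn 𝓘(ℝ, ℂ) 𝓘(ℝ, ℂ).tangent ∞
      (fun z => (⟨φ.symm z, chartSymmDeriv φ z 1⟩ : TangentBundle 𝓘(ℝ, ℂ) S)) φ.target := by
    have h1 := hs.contMDiffOn_tangentMapWithin (m := ∞) le_rfl φ.open_target.uniqueMDiffOn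
    have h2 : ContMDiffOn 𝓘(ℝ, ℂ) 𝓘(ℝ, ℂ).tangent ∞
        (fun z : ℂ => (⟨z, (1 : ℂ)⟩ : TangentBundle 𝓘(ℝ, ℂ) ℂ)) φ.target := fun z _ =>
      contMDiffWithinAt_vectorSpace_iff_contDiffWithinAt.2 contDiffWithinAt_const
    refine (h1.comp h2 fun z hz => hz).congr fun z hz => ?_
    simp only [Function.comp, tangentMapWithin, chartSymmDeriv]
    rw [mfderivWithin_of_isOpen φ.open_target hz]
    rfl
  have hg := g.contMDiff.comp_contMDiffOn hs
  have := ContMDiffOn.clm_bundle_apply₂ (F₁ := ℂ) (F₂ := ℂ) (F₃ := ℝ)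
    (E₁ := fun p : S => TangentSpace 𝓘(ℝ, ℂ) p) (E₂ := fun p : S => TangentSpace 𝓘(ℝ, ℂ) p)
    (E₃ := Bundle.Trivial S ℝ) hg hv hv
  intro z hz
  have h4 := this z hz
  simp only [contMDiffWithinAt_totalSpace] at h4
  exact h4.2.contDiffWithinAt

lemma conformalFactor_pos (g : Metric S) (hφ : φ ∈ atlas ℂ S) {z : ℂ} (hz : z ∈ φ.target) :
    0 < conformalFactor g φ z := by
  refine g.pos _ _ ?_
  rw [chartSymmDeriv_apply hφ hz, mul_one]
  exact deriv_transition_ne_zero hφ (chart_mem_atlas ℂ _) hz (mem_chart_source ℂ _)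

lemma conformalFactor_transition {g : Metric S} (hg : IsIsothermic g) (hφ : φ ∈ atlas ℂ S)
    (hψ : ψ ∈ atlas ℂ S) {z : ℂ} (hz : z ∈ φ.target) (hz' : φ.symm z ∈ ψ.source) :
    conformalFactor g φ z =
      conformalFactor g ψ (ψ (φ.symm z)) * normSq (deriv (ψ ∘ φ.symm) z) := by
  rw [conformalFactor, hg ψ hψ _ hz', chartDeriv_chartSymmDeriv hφ hψ hz hz', mul_one, normSq_apply]

lemma chartVector_transition (b : (p : S) → TangentSpace 𝓘(ℝ, ℂ) p) (hφ : φ ∈ atlas ℂ S)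
    (hψ : ψ ∈ atlas ℂ S) {z : ℂ} (hz : z ∈ φ.target) (hz' : φ.symm z ∈ ψ.source) :
    chartVector b ψ (ψ (φ.symm z)) = chartVector b φ z * deriv (ψ ∘ φ.symm) z := by
  rw [chartVector, ψ.left_inv hz', chartDeriv_transition hφ hψ (φ.map_target hz) hz',
    φ.right_inv hz, chartVector, mul_comm]

end Charts

/-! ### Invariance of the rotor system. -/

section CoordinateChange

open ComplexConjugate

/-- The rotor system is invariant under holomorphic coordinate changes. -/
lemma IsRotorSolutionAt.coordinate_change {lam lam' : ℂ → ℝ} {a a' β β' : ℂ → ℂ} {ρ ρ' : ℂ → ℝ}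
    {k : ℂ → ℂ} {w : ℂ} (hk : AnalyticAt ℂ k w) (hk0 : deriv k w ≠ 0)
    (hl : DifferentiableAt ℝ lam (k w)) (hl0 : lam (k w) ≠ 0)
    (ha : HasWirtingerAt a (dz a (k w)) 0 (k w))
    (hlam : ∀ᶠ v in nhds w, lam' v = lam (k v) * normSq (deriv k v))
    (haa : ∀ᶠ v in nhds w, a (k v) = a' v * deriv k v ^ 3)
    (hββ : ∀ᶠ v in nhds w, β (k v) = β' v * deriv k v) (hρ : ρ (k w) = ρ' w)
    (h : IsRotorSolutionAt (dzLog lam) (rotorQ lam a) β ρ (k w)) :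
    IsRotorSolutionAt (dzLog lam') (rotorQ lam' a') β' ρ' w := by
  have hl0' : (lam (k w) : ℂ) ≠ 0 := by exact_mod_cast hl0
  have hkd : HasDerivAt k (deriv k w) w := hk.differentiableAt.hasDerivAt
  have hk2 : HasWirtingerAt (deriv k) (deriv (deriv k) w) 0 w :=
    .of_hasDerivAt hk.deriv.differentiableAt.hasDerivAt
  have hne : ∀ᶠ v in nhds w, deriv k v ≠ 0 := hk.deriv.continuousAt.eventually_ne hk0
  set d := deriv k w with hd
  set d2 := deriv (deriv k) w
  have hc0 : conj d ≠ 0 := by simpa using hk0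
  have hlw : dz (fun v => (lam' v : ℂ)) w =
      dzLog lam (k w) * lam (k w) * d * (d * conj d) + lam (k w) * (d2 * conj d) := by
    have e := ((hasWirtingerAt_conformal hl hl0).comp_hasDerivAt hkd).mul (hk2.mul hk2.conjugate)
    refine (e.congr_of_eventuallyEq (hlam.mono fun v hv => ?_)).dz_eq.trans ?_
    · rw [hv, ofReal_mul, ← mul_conj]
    · simp [hd]
  have hlam0 : lam' w = lam (k w) * normSq d := hlam.self_of_nhds
  -- The extra term k''/k' of a connection coefficient cancels the second derivative of k produced
  -- by differentiating β and a.
  have hlog : dzLog lam' w = dzLog lam (k w) * d + d2 / d := by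
    rw [dzLog, hlw, hlam0, ofReal_mul, ← mul_conj]
    field_simp
  have haw : HasWirtingerAt a' _ _ w :=
    (((ha.comp_hasDerivAt hkd).div (hk2.mul (hk2.mul hk2)) (by simp [← hd, hk0]))).congr_of_eventuallyEq
      ((haa.and hne).mono fun v hv => by
        have := hv.2
        beta_reduce
        rw [hv.1]
        field_simp)
  have hβw : HasWirtingerAt β' _ _ w :=
    (((HasWirtingerAt.comp_hasDerivAt h hkd)).div hk2 hk0).congr_of_eventuallyEq
      ((hββ.and hne).mono fun v hv => by
        have := hv.2
        beta_reduce
        rw [hv.1]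
        field_simp)
  have ha0 := haa.self_of_nhds
  have hβ0 := hββ.self_of_nhds
  refine hβw.congr_wirtinger ?_ ?_
  · rw [hlog, hρ, hβ0, ← hd]
    field_simp
    ring
  · have hcov : covDzOf lam' 3 a' w = covDzOf lam 3 a (k w) / d ^ 2 := by
      rw [covDzOf, covDzOf, hlog, haw.dz_eq, ha0, ← hd]
      push_cast
      field_simp
      ring
    rw [rotorQ, rotorQ, hcov, hlam0, ofReal_mul, ← mul_conj, ← hd]
    field_simp
    simp

end CoordinateChange

/-! ### Local and global solutions on the surface. -/

section Surface

open ComplexConjugate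

variable {S : Type*} [TopologicalSpace S] [ChartedSpace ℂ S] [IsManifold 𝓘(ℝ, ℂ) ∞ S]
  [IsManifold 𝓘(ℂ) ω S] {φ ψ : OpenPartialHomeomorph S ℂ} {g : Metric S}
  {A : HolomorphicCodifferential S} {K : ℝ}

lemma isothermicData (hK : ∀ φ ∈ atlas ℂ S, ∀ z ∈ φ.target, gaussCurvature g φ z = K)
    (A : HolomorphicCodifferential S) (hφ : φ ∈ atlas ℂ S) :
    IsothermicData φ.target (conformalFactor g φ) (A.coeff φ) K :=
  ⟨φ.open_target, contDiffOn_conformalFactor g hφ, fun _ hz => conformalFactor_pos g hφ hz,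
    hK φ hφ, A.holomorphic φ hφ⟩

lemma IsothermicData.mono {O O' : Set ℂ} {lam : ℂ → ℝ} {a : ℂ → ℂ}
    (hd : IsothermicData O lam a K) (h : O' ⊆ O) (ho : IsOpen O') :
    IsothermicData O' lam a K :=
  ⟨ho, hd.smooth.mono h, fun z hz => hd.pos z (h hz), fun z hz => hd.curvature z (h hz),
    hd.holomorphic.mono h⟩

/-- In the chart `φ` the vector field `b` with the rotor `ρ` is smooth and solves the rotor
system at the point `x`. -/
def IsRotorFieldAtIn (g : Metric S) (A : HolomorphicCodifferential S)
    (b : (p : S) → TangentSpace 𝓘(ℝ, ℂ) p) (ρ : S → ℝ) (φ : OpenPartialHomeomorph S ℂ) (x : S) :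
    Prop :=
  ContDiffAt ℝ ∞ (chartVector b φ) (φ x) ∧
    IsRotorSolutionAt (dzLog (conformalFactor g φ)) (rotorQ (conformalFactor g φ) (A.coeff φ))
      (chartVector b φ) (fun z => ρ (φ.symm z)) (φ x)

/-- The vector field `b` with the rotor `ρ` is smooth and solves the rotor system at `x`. -/
def IsRotorFieldAt (g : Metric S) (A : HolomorphicCodifferential S)
    (b : (p : S) → TangentSpace 𝓘(ℝ, ℂ) p) (ρ : S → ℝ) (x : S) : Prop :=
  ∀ φ ∈ atlas ℂ S, x ∈ φ.source → IsRotorFieldAtIn g A b ρ φ x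

lemma IsRotorFieldAtIn.isRotorFieldAt (hg : IsIsothermic g)
    {b : (p : S) → TangentSpace 𝓘(ℝ, ℂ) p} {ρ : S → ℝ} {x : S} (hφ : φ ∈ atlas ℂ S)
    (hx : x ∈ φ.source) (h : IsRotorFieldAtIn g A b ρ φ x) : IsRotorFieldAt g A b ρ x := by
  intro ψ hψ hx'
  have hz : ψ x ∈ ψ.target := ψ.map_source hx'
  have hz' : ψ.symm (ψ x) ∈ φ.source := by rwa [ψ.left_inv hx']
  have hkw : (φ ∘ ψ.symm) (ψ x) = φ x := by simp [ψ.left_inv hx']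
  have hc := contDiffAt_transition hψ hφ hz hz'
  have hk : AnalyticAt ℂ (φ ∘ ψ.symm) (ψ x) := hc.analyticAt
  have hk0 := deriv_transition_ne_zero hψ hφ hz hz'
  have hev := eventually_mem_transition hz hz'
  have hββ : ∀ᶠ v in nhds (ψ x), chartVector b φ ((φ ∘ ψ.symm) v)
      = chartVector b ψ v * deriv (φ ∘ ψ.symm) v :=
    hev.mono fun v hv => chartVector_transition b hψ hφ hv.1 hv.2
  have hne : ∀ᶠ v in nhds (ψ x), deriv (φ ∘ ψ.symm) v ≠ 0 :=
    hk.deriv.continuousAt.eventually_ne hk0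
  refine ⟨?_, ?_⟩
  · have h1 : ContDiffAt ℝ ∞ (fun v => chartVector b φ ((φ ∘ ψ.symm) v)) (ψ x) := by
      refine ContDiffAt.comp (ψ x) (g := chartVector b φ) ?_ ((hc.of_le le_top).restrict_scalars ℝ)
      rw [hkw]; exact h.1
    have h2 : ContDiffAt ℝ ∞ (deriv (φ ∘ ψ.symm)) (ψ x) :=
      (hk.deriv.contDiffAt (n := ∞)).restrict_scalars ℝ
    refine (h1.mul (h2.inv hk0)).congr_of_eventuallyEq ?_
    filter_upwards [hββ, hne] with v hv hv0
    simp only [hv, Pi.inv_apply]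
    field_simp
  · have hφx : φ x ∈ φ.target := φ.map_source hx
    refine IsRotorSolutionAt.coordinate_change (lam := conformalFactor g φ) (a := A.coeff φ)
      (β := chartVector b φ) (ρ := fun z => ρ (φ.symm z)) hk hk0 ?_ ?_ ?_ ?_ ?_ hββ ?_ ?_
    · rw [hkw]
      exact ((contDiffOn_conformalFactor g hφ).contDiffAt
        (φ.open_target.mem_nhds hφx)).differentiableAt (by simp)
    · rw [hkw]
      exact (conformalFactor_pos g hφ hφx).ne'
    · rw [hkw]
      have := HasWirtingerAt.of_hasDerivAt (((A.holomorphic φ hφ).differentiableAt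
        (φ.open_target.mem_nhds hφx)).hasDerivAt)
      exact this.congr_wirtinger this.dz_eq.symm rfl
    · exact hev.mono fun v hv => conformalFactor_transition hg hψ hφ hv.1 hv.2
    · filter_upwards [hev] with v hv
      have := A.transform ψ hψ φ hφ (ψ.symm v) ⟨ψ.map_target hv.1, hv.2⟩
      rwa [ψ.right_inv hv.1] at this
    · simp [ψ.left_inv hx', φ.left_inv hx]
    · rw [hkw]; exact h.2

lemma IsRotorFieldAt.congr {b b' : (p : S) → TangentSpace 𝓘(ℝ, ℂ) p} {ρ ρ' : S → ℝ} {x : S}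
    (hb : ∀ᶠ p in nhds x, b p = b' p) (hρ : ρ x = ρ' x) (h : IsRotorFieldAt g A b ρ x) :
    IsRotorFieldAt g A b' ρ' x := by
  intro φ hφ hx
  obtain ⟨h1, h2⟩ := h φ hφ hx
  have hev : chartVector b' φ =ᶠ[nhds (φ x)] chartVector b φ := by
    have := (φ.continuousAt_symm (φ.map_source hx)).tendsto
    rw [φ.left_inv hx] at this
    filter_upwards [this.eventually hb] with z hz
    rw [chartVector, chartVector, hz]
  refine ⟨h1.congr_of_eventuallyEq hev, ?_⟩
  refine (HasWirtingerAt.congr_of_eventuallyEq h2 hev).congr_wirtinger ?_ rfl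
  beta_reduce
  rw [hev.self_of_nhds, φ.left_inv hx, hρ]

/-- The vector field with the components `β` in the chart `φ`. -/
noncomputable def fieldOfChart (φ : OpenPartialHomeomorph S ℂ) (β : ℂ → ℂ) (p : S) :
    TangentSpace 𝓘(ℝ, ℂ) p :=
  show ℂ from β (φ p) / deriv (φ ∘ (chartAt ℂ p).symm) (chartAt ℂ p p)

lemma deriv_chartAt_ne_zero (hφ : φ ∈ atlas ℂ S) {p : S} (hp : p ∈ φ.source) :
    deriv (φ ∘ (chartAt ℂ p).symm) (chartAt ℂ p p) ≠ 0 :=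
  deriv_transition_ne_zero (chart_mem_atlas ℂ p) hφ (mem_chart_target ℂ p)
    (by rwa [(chartAt ℂ p).left_inv (mem_chart_source ℂ p)])

lemma chartVector_fieldOfChart (hφ : φ ∈ atlas ℂ S) (β : ℂ → ℂ) {z : ℂ} (hz : z ∈ φ.target) :
    chartVector (fieldOfChart φ β) φ z = β z := by
  rw [chartVector, chartDeriv_apply hφ (φ.map_target hz), fieldOfChart, φ.right_inv hz]
  exact mul_div_cancel₀ _ (deriv_chartAt_ne_zero hφ (φ.map_target hz))

lemma eq_of_chartVector_eq (hφ : φ ∈ atlas ℂ S) {b b' : (p : S) → TangentSpace 𝓘(ℝ, ℂ) p} {p : S}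
    (hp : p ∈ φ.source) (h : chartVector b φ (φ p) = chartVector b' φ (φ p)) : b p = b' p := by
  have e : ∀ c : (p : S) → TangentSpace 𝓘(ℝ, ℂ) p,
      chartVector c φ (φ p) = chartDeriv φ p (c p) := by
    intro c
    exact congrArg (fun q => chartDeriv φ q (c q) : S → ℂ) (φ.left_inv hp)
  rw [e, e, chartDeriv_apply hφ hp, chartDeriv_apply hφ hp] at h
  exact mul_left_cancel₀ (M₀ := ℂ) (deriv_chartAt_ne_zero hφ hp) h

lemma chartVector_eq_of_eq {b b' : (p : S) → TangentSpace 𝓘(ℝ, ℂ) p} {z : ℂ}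
    (h : b (φ.symm z) = b' (φ.symm z)) : chartVector b φ z = chartVector b' φ z := by
  rw [chartVector, chartVector, h]

lemma exists_ball_subset_chartImage {U : Set S} (hU : IsOpen U) {x : S} (hx : x ∈ φ.source)
    (hxU : x ∈ U) : ∃ r > 0, Metric.ball (φ x) r ⊆ chartImage φ U :=
  Metric.isOpen_iff.1 (isOpen_chartImage φ hU) _
    ⟨φ.map_source hx, by rwa [Set.mem_preimage, φ.left_inv hx]⟩

/-- The part of the surface over a ball in the chart `φ`. -/
def chartBall (φ : OpenPartialHomeomorph S ℂ) (z : ℂ) (r : ℝ) : Set S :=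
  φ.source ∩ φ ⁻¹' Metric.ball z r

lemma isOpen_chartBall (φ : OpenPartialHomeomorph S ℂ) (z : ℂ) (r : ℝ) :
    IsOpen (chartBall φ z r) := φ.isOpen_inter_preimage Metric.isOpen_ball

lemma mem_chartBall {x : S} {r : ℝ} (hx : x ∈ φ.source) (hr : 0 < r) :
    x ∈ chartBall φ (φ x) r := ⟨hx, Metric.mem_ball_self hr⟩

lemma symm_mem_chartBall {z z₀ : ℂ} {r : ℝ} (hr : Metric.ball z₀ r ⊆ φ.target)
    (hz : z ∈ Metric.ball z₀ r) : φ.symm z ∈ chartBall φ z₀ r :=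
  ⟨φ.map_target (hr hz), by rwa [Set.mem_preimage, φ.right_inv (hr hz)]⟩

lemma eqOn_chartBall (hK : ∀ φ ∈ atlas ℂ S, ∀ z ∈ φ.target, gaussCurvature g φ z = K)
    (hφ : φ ∈ atlas ℂ S) {z₀ : ℂ} {r : ℝ} (hr : Metric.ball z₀ r ⊆ φ.target)
    {b b' : (p : S) → TangentSpace 𝓘(ℝ, ℂ) p} {ρ ρ' : S → ℝ}
    (h : ∀ p ∈ chartBall φ z₀ r, IsRotorFieldAtIn g A b ρ φ p)
    (h' : ∀ p ∈ chartBall φ z₀ r, IsRotorFieldAtIn g A b' ρ' φ p) {y : S}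
    (hy : y ∈ chartBall φ z₀ r) (hb : b y = b' y) (hρ : ρ y = ρ' y) :
    ∀ p ∈ chartBall φ z₀ r, b p = b' p ∧ ρ p = ρ' p := by
  have key : ∀ {b : (p : S) → TangentSpace 𝓘(ℝ, ℂ) p} {ρ : S → ℝ},
      (∀ p ∈ chartBall φ z₀ r, IsRotorFieldAtIn g A b ρ φ p) → ∀ z ∈ Metric.ball z₀ r,
      ContDiffAt ℝ ∞ (chartVector b φ) z ∧ IsRotorSolutionAt (dzLog (conformalFactor g φ))
        (rotorQ (conformalFactor g φ) (A.coeff φ)) (chartVector b φ) (fun z => ρ (φ.symm z)) z := by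
    intro b ρ h z hz
    have := h _ (symm_mem_chartBall hr hz)
    rwa [IsRotorFieldAtIn, φ.right_inv (hr hz)] at this
  have hsymm : φ.symm (φ y) = y := φ.left_inv hy.1
  have := (isothermicData hK A hφ).rotorCoefficients.eqOn_of_isRotorSolutionAt (convex_ball z₀ r)
    Metric.isOpen_ball hr (fun z hz => (key h z hz).1.contDiffWithinAt)
    (fun z hz => (key h' z hz).1.contDiffWithinAt)
    (fun z hz => (key h z hz).2) (fun z hz => (key h' z hz).2) hy.2
    (chartVector_eq_of_eq (by rw [hsymm, hb])) (by simp only [hsymm, hρ])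
  intro p hp
  refine ⟨eq_of_chartVector_eq hφ hp.1 (this.1 hp.2), ?_⟩
  have h2 := this.2 hp.2
  simpa [φ.left_inv hp.1] using h2

/-- The local solution is found in a single chart, and invariance under coordinate changes transfers
the equation to all others. -/
lemma exists_chartBall_isRotorFieldAt (hg : IsIsothermic g)
    (hK : ∀ φ ∈ atlas ℂ S, ∀ z ∈ φ.target, gaussCurvature g φ z = K) {U : Set S} (hU : IsOpen U)
    (hD : D₀VanishesOn g A U) (hφ : φ ∈ atlas ℂ S) {x : S} (hx : x ∈ φ.source) (hxU : x ∈ U) :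
    ∃ r > 0, Metric.ball (φ x) r ⊆ chartImage φ U ∧ ∀ y ∈ chartBall φ (φ x) r,
      ∀ (v : TangentSpace 𝓘(ℝ, ℂ) y) (w : ℝ), ∃ (b : (p : S) → TangentSpace 𝓘(ℝ, ℂ) p) (ρ : S → ℝ),
        b y = v ∧ ρ y = w ∧ ∀ p ∈ chartBall φ (φ x) r, IsRotorFieldAt g A b ρ p := by
  have hd := (isothermicData hK A hφ).mono (O' := chartImage φ U) Set.inter_subset_left
    (isOpen_chartImage φ hU)
  obtain ⟨r, hr, hrU, hex⟩ := hd.rotorCoefficients.exists_ball_isRotorSolutionAt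
    (fun z hz => (hd.re_dz_rotorR_eq_zero_iff hz).2 (hD φ hφ z hz))
    (z₀ := φ x) ⟨φ.map_source hx, by rwa [Set.mem_preimage, φ.left_inv hx]⟩
  have hrt : Metric.ball (φ x) r ⊆ φ.target := hrU.trans Set.inter_subset_left
  refine ⟨r, hr, hrU, fun y hy v w => ?_⟩
  obtain ⟨β, σ, hβy, hσy, hβ, hsol⟩ := hex (φ y) hy.2 (chartDeriv φ y v) w
  refine ⟨fieldOfChart φ β, fun p => σ (φ p), ?_, hσy, fun p hp => ?_⟩
  · rw [fieldOfChart, hβy, chartDeriv_apply hφ hy.1]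
    exact mul_div_cancel_left₀ _ (deriv_chartAt_ne_zero hφ hy.1)
  · refine IsRotorFieldAtIn.isRotorFieldAt hg hφ hp.1 ?_
    have hev : chartVector (fieldOfChart φ β) φ =ᶠ[nhds (φ p)] β := by
      filter_upwards [φ.open_target.eventually_mem (φ.map_source hp.1)] with z hz
      exact chartVector_fieldOfChart hφ β hz
    refine ⟨(hβ.contDiffAt (Metric.isOpen_ball.mem_nhds hp.2)).congr_of_eventuallyEq hev, ?_⟩
    refine (HasWirtingerAt.congr_of_eventuallyEq (hsol (φ p) hp.2) hev).congr_wirtinger ?_ rfl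
    beta_reduce
    rw [hev.self_of_nhds, φ.left_inv hp.1]

theorem exists_isRotorFieldAt (hg : IsIsothermic g)
    (hK : ∀ φ ∈ atlas ℂ S, ∀ z ∈ φ.target, gaussCurvature g φ z = K) {U : Set S} (hU : IsOpen U)
    (hsc : IsSimplyConnected U) (hD : D₀VanishesOn g A U) {P : S} (hP : P ∈ U)
    (v : TangentSpace 𝓘(ℝ, ℂ) P) (w : ℝ) :
    ∃ (b : (p : S) → TangentSpace 𝓘(ℝ, ℂ) p) (ρ : S → ℝ), b P = v ∧ ρ P = w ∧
      ∀ p ∈ U, IsRotorFieldAt g A b ρ p := by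
  have : LocallyPathConnectedSpace S := ChartedSpace.locallyPathConnectedSpace ℂ S
  -- Each tangent plane is identified with ℂ through the preferred chart at its point. This may jump
  -- from point to point, which is harmless because the continuation theorem only compares values
  -- pointwise.
  let fld : (S → ℂ × ℝ) → (p : S) → TangentSpace 𝓘(ℝ, ℂ) p := fun s p => (s p).1
  have huniq : ∀ {x : S} {r : ℝ}, Metric.ball (chartAt ℂ x x) r ⊆ (chartAt ℂ x).target →
      ∀ s s' : S → ℂ × ℝ,
      (∀ z ∈ chartBall (chartAt ℂ x) (chartAt ℂ x x) r,
        IsRotorFieldAt g A (fld s) (fun p => (s p).2) z) →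
      (∀ z ∈ chartBall (chartAt ℂ x) (chartAt ℂ x x) r,
        IsRotorFieldAt g A (fld s') (fun p => (s' p).2) z) →
      ∀ y ∈ chartBall (chartAt ℂ x) (chartAt ℂ x x) r, s y = s' y →
        Set.EqOn s s' (chartBall (chartAt ℂ x) (chartAt ℂ x x) r) := by
    intro x r hr s s' hs hs' y hy hsy z hz
    have := eqOn_chartBall hK (chart_mem_atlas ℂ x) hr
      (fun p hp => hs p hp _ (chart_mem_atlas ℂ x) hp.1)
      (fun p hp => hs' p hp _ (chart_mem_atlas ℂ x) hp.1) hy (congrArg Prod.fst hsy)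
      (congrArg Prod.snd hsy) z hz
    exact Prod.ext this.1 this.2
  have hex : ∀ x ∈ U, ∃ W, IsOpen W ∧ x ∈ W ∧ (∀ y ∈ W, ∀ v : ℂ × ℝ, ∃ s : S → ℂ × ℝ, s y = v ∧
      ∀ z ∈ W, IsRotorFieldAt g A (fld s) (fun p => (s p).2) z) ∧
      ∀ s s' : S → ℂ × ℝ, (∀ z ∈ W, IsRotorFieldAt g A (fld s) (fun p => (s p).2) z) →
        (∀ z ∈ W, IsRotorFieldAt g A (fld s') (fun p => (s' p).2) z) →
        ∀ y ∈ W, s y = s' y → Set.EqOn s s' W := by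
    intro x hx
    obtain ⟨r, hr, hrU, hex⟩ := exists_chartBall_isRotorFieldAt hg hK hU hD (chart_mem_atlas ℂ x)
      (mem_chart_source ℂ x) hx
    refine ⟨chartBall (chartAt ℂ x) (chartAt ℂ x x) r, isOpen_chartBall _ _ _,
      mem_chartBall (mem_chart_source ℂ x) hr, fun y hy v => ?_,
      huniq (hrU.trans Set.inter_subset_left)⟩
    obtain ⟨b, ρ, hb, hρ, h⟩ := hex y hy v.1 v.2
    exact ⟨fun p => (b p, ρ p), Prod.ext hb hρ, h⟩
  have hloc : ∀ x ∈ U, ∀ s s' : S → ℂ × ℝ,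
      (∀ᶠ y in nhds x, IsRotorFieldAt g A (fld s) (fun p => (s p).2) y) →
      (∀ᶠ y in nhds x, IsRotorFieldAt g A (fld s') (fun p => (s' p).2) y) → s x = s' x →
      s =ᶠ[nhds x] s' := by
    intro x hx s s' hs hs' hsx
    -- The ball lies over the interior of the set where both fields solve the system, so uniqueness
    -- on a ball applies.
    obtain ⟨r, hr, hrU⟩ := exists_ball_subset_chartImage (φ := chartAt ℂ x)
      (isOpen_interior (s := {z | IsRotorFieldAt g A (fld s) (fun p => (s p).2) z ∧
        IsRotorFieldAt g A (fld s') (fun p => (s' p).2) z})) (mem_chart_source ℂ x)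
      (mem_interior_iff_mem_nhds.2 (hs.and hs'))
    have hin : ∀ p ∈ chartBall (chartAt ℂ x) (chartAt ℂ x x) r,
        IsRotorFieldAt g A (fld s) (fun p => (s p).2) p ∧
        IsRotorFieldAt g A (fld s') (fun p => (s' p).2) p := by
      intro p hp
      have := interior_subset (hrU hp.2).2
      rwa [(chartAt ℂ x).left_inv hp.1] at this
    exact (huniq (hrU.trans Set.inter_subset_left) s s' (fun z hz => (hin z hz).1)
      (fun z hz => (hin z hz).2) x (mem_chartBall (mem_chart_source ℂ x) hr) hsx).eventuallyEq_of_mem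
      ((isOpen_chartBall _ _ _).mem_nhds (mem_chartBall (mem_chart_source ℂ x) hr))
  obtain ⟨s, hsP, hs⟩ := hsc.exists_forall_of_locally_existsUnique (V := ℂ × ℝ) hU
    (fun s x => IsRotorFieldAt g A (fld s) (fun p => (s p).2) x)
    (fun s s' x he h => h.congr (he.mono fun p hp => congrArg Prod.fst hp)
      (congrArg Prod.snd he.self_of_nhds))
    hex hloc hP ((show ℂ from v), w)
  exact ⟨fld s, fun p => (s p).2, congrArg Prod.fst hsP, congrArg Prod.snd hsP, hs⟩

end Surface

/-! ### Correspondence between cubic integrals and solutions of the rotor system. -/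

section Integrals

open ComplexConjugate

/-- This fixes the factor 8 in b = 8β/λ: twice the Hamiltonian is 4|p|²/λ and b^i p_i is 2 Re(βp).
-/
lemma re_cubic_add_eq (a β : ℂ) {l : ℝ} (hl : l ≠ 0) (px py : ℝ) :
    (a * complexMomentum px py ^ 3).re + 2 * ((px ^ 2 + py ^ 2) / (2 * l)) * (β.re * px + β.im * py)
      = (a * complexMomentum px py ^ 3
          + 8 * β / l * complexMomentum px py ^ 2 * star (complexMomentum px py)).re := by
  have hl' : (l : ℂ) ≠ 0 := by exact_mod_cast hl
  have h1 : complexMomentum px py * star (complexMomentum px py)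
      = (((px ^ 2 + py ^ 2) / 4 : ℝ) : ℂ) := by
    rw [star_def, mul_conj]
    congr 1
    simp [complexMomentum, normSq_apply]
    ring
  have h2 : 8 * β / l * complexMomentum px py ^ 2 * star (complexMomentum px py)
      = ((2 * (px ^ 2 + py ^ 2) / l : ℝ) : ℂ) * (β * complexMomentum px py) := by
    have : 8 * β / l * complexMomentum px py ^ 2 * star (complexMomentum px py)
      = 8 * β / l * complexMomentum px py * (complexMomentum px py * star (complexMomentum px py)) := by
      ring
    rw [this, h1]
    push_cast
    ring
  have h3 : (β * complexMomentum px py).re = (β.re * px + β.im * py) / 2 := by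
    simp [complexMomentum]
    ring
  rw [add_re, h2, re_ofReal_mul, h3]
  field_simp

lemma re_cubic_eq (a c : ℂ) (px py : ℝ) :
    (a * complexMomentum px py ^ 3
          + c * complexMomentum px py ^ 2 * star (complexMomentum px py)).re
      = (a.re + c.re) / 8 * px ^ 3 + (3 * a.im + c.im) / 8 * px ^ 2 * py
        + (-3 * a.re + c.re) / 8 * px * py ^ 2 + (-a.im + c.im) / 8 * py ^ 3 := by
  simp only [complexMomentum, star_def, pow_succ, pow_zero, one_mul, add_re, mul_re, mul_im,
    sub_re, sub_im, conj_re, conj_im, I_re, I_im, ofReal_re, ofReal_im, div_ofNat_re,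
    div_ofNat_im]
  ring

variable {S : Type*} [TopologicalSpace S] [ChartedSpace ℂ S] [IsManifold 𝓘(ℝ, ℂ) ∞ S]
  [IsManifold 𝓘(ℂ) ω S] {φ ψ : OpenPartialHomeomorph S ℂ} {g : Metric S}
  {A : HolomorphicCodifferential S} {K : ℝ} {U : Set S} {F : (p : S) → Cotangent p → ℝ}
  {b b' : (p : S) → TangentSpace 𝓘(ℝ, ℂ) p}

lemma chartImage_mem_source {z : ℂ} (hz : z ∈ chartImage φ U) :
    φ.symm z ∈ φ.source ∧ φ.symm z ∈ U ∧ φ (φ.symm z) = z :=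
  ⟨φ.map_target hz.1, hz.2, φ.right_inv hz.1⟩

lemma CubicIntegrals.HasFormOn.chartExpr_eq (h : HasFormOn g A b U F) (hφ : φ ∈ atlas ℂ S) {z : ℂ}
    (hz : z ∈ chartImage φ U) (px py : ℝ) :
    chartExpr F φ z px py = (A.coeff φ z * complexMomentum px py ^ 3
      + 8 * chartVector b φ z / conformalFactor g φ z * complexMomentum px py ^ 2
        * star (complexMomentum px py)).re := by
  rw [h φ hφ z hz, ← re_cubic_add_eq _ _ (conformalFactor_pos g hφ hz.1).ne']
  rfl

lemma poissonBracket_eq_zero_iff_isRotorSolutionAt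
    (hK : ∀ φ ∈ atlas ℂ S, ∀ z ∈ φ.target, gaussCurvature g φ z = K) (hU : IsOpen U)
    (hφ : φ ∈ atlas ℂ S) {β : ℂ → ℂ} {z : ℂ} (hz : z ∈ chartImage φ U) (hβ : DifferentiableAt ℝ β z)
    (hF : ∀ w ∈ chartImage φ U, ∀ px py, chartExpr F φ w px py =
      (A.coeff φ w * complexMomentum px py ^ 3 + 8 * β w / conformalFactor g φ w
        * complexMomentum px py ^ 2 * star (complexMomentum px py)).re) :
    (∀ px py, poissonBracket (hamiltonian g φ) (chartExpr F φ) z px py = 0) ↔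
      IsRotorSolutionAt (dzLog (conformalFactor g φ))
        (rotorQ (conformalFactor g φ) (A.coeff φ)) β
        (fun w => 2 * (dz β w + dzLog (conformalFactor g φ) w * β w).im) z := by
  rw [isRotorSolutionAt_iff hβ]
  exact (isothermicData hK A hφ).poissonBracket_eq_zero_iff hz.1 hβ (fun _ _ _ => rfl)
    (((isOpen_chartImage φ hU).eventually_mem hz).mono hF)

/-- A complex number as a tangent vector, in the coordinate of the preferred chart at `p`. -/
def tangentVector (p : S) (v : ℂ) : TangentSpace 𝓘(ℝ, ℂ) p := v

/-- The cubic form `Re A + 2 H b^i p_i`. -/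
noncomputable def cubicForm (g : Metric S) (A : HolomorphicCodifferential S)
    (b : (p : S) → TangentSpace 𝓘(ℝ, ℂ) p) (p : S) (ξ : Cotangent p) : ℝ :=
  A.rePart (chartAt ℂ p) (chartAt ℂ p p) (ξ (tangentVector p 1)) (ξ (tangentVector p I))
    + 2 * hamiltonian g (chartAt ℂ p) (chartAt ℂ p p) (ξ (tangentVector p 1)) (ξ (tangentVector p I))
      * ξ (b p)

lemma chartCovector_apply (hφ : φ ∈ atlas ℂ S) {p : S} (hp : p ∈ φ.source) (px py : ℝ)
    (v : ℂ) :
    chartCovector φ p px py (tangentVector p v) =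
      px * (deriv (φ ∘ (chartAt ℂ p).symm) (chartAt ℂ p p) * v).re
      + py * (deriv (φ ∘ (chartAt ℂ p).symm) (chartAt ℂ p p) * v).im := by
  have h := chartDeriv_apply hφ hp (tangentVector p v)
  have e : chartCovector φ p px py (tangentVector p v) =
    px * (chartDeriv φ p (tangentVector p v)).re + py * (chartDeriv φ p (tangentVector p v)).im := rfl
  rw [e, h]
  rfl

/-- With τ the derivative of the transition from the preferred chart to φ, the momentum p, the
coefficient a and the factor λ pick up τ, τ³ and |τ|² in compensating directions. -/
lemma hasFormOn_cubicForm (hg : IsIsothermic g) : HasFormOn g A b U (cubicForm g A b) := by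
  intro φ hφ z hz px py
  obtain ⟨hp, -, hpz⟩ := chartImage_mem_source hz
  rw [chartExpr, cubicForm, chartCovector_apply hφ hp, chartCovector_apply hφ hp]
  generalize hp0 : φ.symm z = p at *
  set χ := chartAt ℂ p
  have hχ : χ.symm (χ p) = p := χ.left_inv (mem_chart_source ℂ p)
  have hA := A.transform χ (chart_mem_atlas ℂ p) φ hφ p ⟨mem_chart_source ℂ p, hp⟩
  have hl := conformalFactor_transition hg (chart_mem_atlas ℂ p) hφ (mem_chart_target ℂ p)
    (by rwa [hχ])
  have h0 := deriv_chartAt_ne_zero hφ hp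
  rw [hχ, hpz] at hl
  rw [hpz] at hA
  set τ := deriv (φ ∘ χ.symm) (χ p)
  have hm : complexMomentum (px * (τ * 1).re + py * (τ * 1).im)
      (px * (τ * I).re + py * (τ * I).im) = τ * complexMomentum px py := by
    apply Complex.ext <;> simp [complexMomentum] <;> ring
  have hb : chartCovector φ p px py (b p) =
      (chartVector b φ z).re * px + (chartVector b φ z).im * py := by
    subst hp0
    rw [mul_comm _ px, mul_comm _ py]
    rfl
  have hn : (px * (τ * 1).re + py * (τ * 1).im) ^ 2 + (px * (τ * I).re + py * (τ * I).im) ^ 2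
      = normSq τ * (px ^ 2 + py ^ 2) := by
    simp [normSq_apply]; ring
  have hn0 : normSq τ ≠ 0 := by simpa using h0
  have hl0 := (conformalFactor_pos g hφ hz.1).ne'
  rw [hb]
  congr 1
  · refine (congrArg (fun m => (A.coeff χ (χ p) * m ^ 3).re) hm).trans ?_
    rw [HolomorphicCodifferential.rePart, hA]
    congr 1
    ring
  · congr 2
    refine (congrArg (fun m => m / (2 * conformalFactor g χ (χ p))) hn).trans ?_
    rw [hl, hamiltonian]
    field_simp

lemma CubicIntegrals.HasFormOn.apply_eq_cubicForm (h : HasFormOn g A b U F) {p : S} (hp : p ∈ U)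
    (ξ : Cotangent p) : F p ξ = cubicForm g A b p ξ := by
  have hχ : (chartAt ℂ p).symm (chartAt ℂ p p) = p :=
    (chartAt ℂ p).left_inv (mem_chart_source ℂ p)
  have hξ : ξ = chartCovector (chartAt ℂ p) p (ξ (tangentVector p 1)) (ξ (tangentVector p I)) := by
    suffices h : ∀ c, ξ (tangentVector p c) = chartCovector (chartAt ℂ p) p (ξ (tangentVector p 1))
        (ξ (tangentVector p I)) (tangentVector p c) from ContinuousLinearMap.ext h
    intro c
    rw [chartCovector_apply (chart_mem_atlas ℂ p) (mem_chart_source ℂ p),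
      deriv_transition_self (mem_chart_target ℂ p), one_mul]
    have hv : tangentVector p c = c.re • tangentVector p 1 + c.im • tangentVector p I := by
      refine (re_add_im c).symm.trans ?_
      rw [← mul_one (c.re : ℂ)]
      rfl
    conv_lhs => rw [hv, map_add, map_smul, map_smul, smul_eq_mul, smul_eq_mul]
    ring
  have h1 := h (chartAt ℂ p) (chart_mem_atlas ℂ p) (chartAt ℂ p p)
    ⟨mem_chart_target ℂ p, by rwa [Set.mem_preimage, hχ]⟩ (ξ (tangentVector p 1)) (ξ (tangentVector p I))
  have h2 : chartExpr F (chartAt ℂ p) (chartAt ℂ p p) (ξ (tangentVector p 1)) (ξ (tangentVector p I))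
      = F p ξ :=
    (congrArg (fun q => F q (chartCovector (chartAt ℂ p) q (ξ (tangentVector p 1))
      (ξ (tangentVector p I)))) hχ).trans (congrArg (F p) hξ.symm)
  have h3 : (chartVector b (chartAt ℂ p) (chartAt ℂ p p)).re * ξ (tangentVector p 1)
      + (chartVector b (chartAt ℂ p) (chartAt ℂ p p)).im * ξ (tangentVector p I) = ξ (b p) := by
    have e : chartVector b (chartAt ℂ p) (chartAt ℂ p p) = chartDeriv (chartAt ℂ p) p (b p) :=
      congrArg (fun q => (chartDeriv (chartAt ℂ p) q (b q) : ℂ)) hχ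
    rw [e, mul_comm, mul_comm _ (ξ (tangentVector p I))]
    conv_rhs => rw [hξ]
    rfl
  rw [← h2, h1, h3]
  rfl

lemma IsRotorFieldAt.isSmoothVectorFieldOn {ρ : S → ℝ} (h : ∀ p ∈ U, IsRotorFieldAt g A b ρ p) :
    IsSmoothVectorFieldOn U b := by
  intro φ hφ z hz
  obtain ⟨hp, hpU, hpz⟩ := chartImage_mem_source hz
  have := (h _ hpU φ hφ hp).1
  rw [hpz] at this
  exact this.contDiffWithinAt

lemma IsRotorFieldAt.isCubicIntegralOn
    (hK : ∀ φ ∈ atlas ℂ S, ∀ z ∈ φ.target, gaussCurvature g φ z = K) (hU : IsOpen U) {ρ : S → ℝ}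
    (h : ∀ p ∈ U, IsRotorFieldAt g A b ρ p) (hF : HasFormOn g A b U F) :
    IsCubicIntegralOn g U F := by
  have hs := IsRotorFieldAt.isSmoothVectorFieldOn h
  intro φ hφ
  have hd := isothermicData hK A hφ
  have ha : ContDiffOn ℝ ∞ (A.coeff φ) (chartImage φ U) := fun z hz =>
    (hd.contDiffAt_coeff hz.1).contDiffWithinAt
  have hc : ContDiffOn ℝ ∞ (fun z => 8 * chartVector b φ z / conformalFactor g φ z)
      (chartImage φ U) := by
    have hl : ContDiffOn ℝ ∞ (fun z => (conformalFactor g φ z : ℂ)) (chartImage φ U) :=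
      ofRealCLM.contDiff.comp_contDiffOn (hd.smooth.mono Set.inter_subset_left)
    exact ((contDiffOn_const (c := (8 : ℂ))).mul (hs φ hφ)).mul
      (hl.inv fun z hz => ofReal_ne_zero.2 (hd.ne_zero hz.1))
  have har := reCLM.contDiff.comp_contDiffOn (n := ∞) ha
  have hai := imCLM.contDiff.comp_contDiffOn (n := ∞) ha
  have hcr := reCLM.contDiff.comp_contDiffOn (n := ∞) hc
  have hci := imCLM.contDiff.comp_contDiffOn (n := ∞) hc
  refine ⟨⟨_, _, _, _, (har.add hcr).div_const 8,
    (((contDiffOn_const (c := (3 : ℝ))).mul hai).add hci).div_const 8,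
    (((contDiffOn_const (c := (-3 : ℝ))).mul har).add hcr).div_const 8, (hai.neg.add hci).div_const 8,
    fun z hz px py => ?_⟩, fun z hz => ?_⟩
  · rw [hF.chartExpr_eq hφ hz, re_cubic_eq]
    rfl
  · obtain ⟨hp, hpU, hpz⟩ := chartImage_mem_source hz
    have hr := h _ hpU φ hφ hp
    rw [IsRotorFieldAtIn, hpz] at hr
    have hβ : DifferentiableAt ℝ (chartVector b φ) z := hr.1.differentiableAt (by simp)
    refine (poissonBracket_eq_zero_iff_isRotorSolutionAt hK hU hφ hz hβ
      fun w hw => hF.chartExpr_eq hφ hw).2 ((isRotorSolutionAt_iff hβ).2 ?_)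
    refine ⟨HasWirtingerAt.dzb_eq hr.2, ?_⟩
    rw [HasWirtingerAt.dz_eq hr.2]
    simp

lemma CubicIntegrals.HasFormOn.isBirkhoffKolokoltsovOn (hF : HasFormOn g A b U F) :
    IsBirkhoffKolokoltsovOn A U F := fun _ hφ _ hz => ⟨_, hF.chartExpr_eq hφ hz⟩

lemma IsRotorFieldAt.isCompatibleOn (hg : IsIsothermic g)
    (hK : ∀ φ ∈ atlas ℂ S, ∀ z ∈ φ.target, gaussCurvature g φ z = K) (hU : IsOpen U) {ρ : S → ℝ}
    (h : ∀ p ∈ U, IsRotorFieldAt g A b ρ p) : IsCompatibleOn g A U :=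
  ⟨_, IsRotorFieldAt.isCubicIntegralOn hK hU h (hasFormOn_cubicForm hg),
    (hasFormOn_cubicForm hg).isBirkhoffKolokoltsovOn⟩

/-- A cubic integral with leading part A yields a solution β of the rotor system in each chart, and
this forces Re R_z = 0. -/
lemma CubicIntegrals.IsCompatibleOn.d₀VanishesOn
    (hK : ∀ φ ∈ atlas ℂ S, ∀ z ∈ φ.target, gaussCurvature g φ z = K) (hU : IsOpen U)
    (h : IsCompatibleOn g A U) : D₀VanishesOn g A U := by
  obtain ⟨F, hF, hBK⟩ := h
  intro φ hφ z hz
  have hd := (isothermicData hK A hφ).mono (O' := chartImage φ U) Set.inter_subset_left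
    (isOpen_chartImage φ hU)
  obtain ⟨⟨a₀, a₁, a₂, a₃, h₀, -, -, h₃, hexpr⟩, hbr⟩ := hF φ hφ
  -- The coefficient of p² p̄ is given only pointwise, so it is recovered from the smooth
  -- coefficients of p_x³ and p_y³, which are (Re a + Re c)/8 and (-Im a + Im c)/8.
  let c : ℂ → ℂ := fun w => ((8 * a₀ w - (A.coeff φ w).re : ℝ) : ℂ)
    + ((8 * a₃ w + (A.coeff φ w).im : ℝ) : ℂ) * I
  let β : ℂ → ℂ := fun w => conformalFactor g φ w * c w / 8
  have hβ : ∀ w ∈ chartImage φ U, ContDiffAt ℝ ∞ β w := by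
    intro w hw
    have ha := hd.contDiffAt_coeff hw
    have har := reCLM.contDiff.contDiffAt.comp (n := ∞) w ha
    have hai := imCLM.contDiff.contDiffAt.comp (n := ∞) w ha
    have hn := hd.isOpen.mem_nhds hw
    have h1 := (contDiffAt_const (c := (8 : ℝ))).mul (h₀.contDiffAt hn)
    have h2 := (contDiffAt_const (c := (8 : ℝ))).mul (h₃.contDiffAt hn)
    have hl := ofRealCLM.contDiff.contDiffAt.comp (n := ∞) w (hd.contDiffAt hw)
    exact (hl.mul ((ofRealCLM.contDiff.contDiffAt.comp (n := ∞) w (h1.sub har)).add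
      ((ofRealCLM.contDiff.contDiffAt.comp (n := ∞) w (h2.add hai)).mul
        contDiffAt_const))).div_const 8
  have hcub : ∀ w ∈ chartImage φ U, ∀ px py, chartExpr F φ w px py =
      (A.coeff φ w * complexMomentum px py ^ 3 + 8 * β w / conformalFactor g φ w
        * complexMomentum px py ^ 2 * star (complexMomentum px py)).re := by
    intro w hw px py
    obtain ⟨e, he⟩ := hBK φ hφ w hw
    have h1 := he 1 0
    have h2 := he 0 1
    rw [hexpr w hw, re_cubic_eq] at h1 h2
    have hl : (conformalFactor g φ w : ℂ) ≠ 0 := by exact_mod_cast hd.ne_zero hw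
    have hce : e = 8 * β w / conformalFactor g φ w := by
      have : 8 * β w / conformalFactor g φ w = c w := by
        simp only [β]; field_simp
      rw [this]
      apply Complex.ext
      · simp [c]; linarith
      · simp [c]; linarith
    rw [he, hce]
  refine (hd.re_dz_rotorR_eq_zero_iff hz).1 (hd.rotorCoefficients.re_dz_R_eq_zero hz
    (β := β) (ρ := fun w => 2 * (dz β w + dzLog (conformalFactor g φ) w * β w).im) ?_)
  filter_upwards [hd.isOpen.eventually_mem hz] with w hw
  exact ⟨hβ w hw, (poissonBracket_eq_zero_iff_isRotorSolutionAt hK hU hφ hw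
    ((hβ w hw).differentiableAt (by simp)) hcub).1 (hbr w hw)⟩

/-- The rotor of a vector field in the isothermic coordinate `φ`. -/
noncomputable def chartRot (g : Metric S) (b : (p : S) → TangentSpace 𝓘(ℝ, ℂ) p)
    (φ : OpenPartialHomeomorph S ℂ) (z : ℂ) : ℝ :=
  2 * (dz (chartVector b φ) z + dzLog (conformalFactor g φ) z * chartVector b φ z).im

lemma rot_eq_chartRot (P : S)
    (hb : DifferentiableAt ℝ (chartVector b (chartAt ℂ P)) (chartAt ℂ P P)) :
    rot g b P = chartRot g b (chartAt ℂ P) (chartAt ℂ P P) := by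
  have hχ := chart_mem_atlas ℂ P
  have hl : DifferentiableAt ℝ (conformalFactor g (chartAt ℂ P)) (chartAt ℂ P P) :=
    ((contDiffOn_conformalFactor g hχ).contDiffAt ((chartAt ℂ P).open_target.mem_nhds
      (mem_chart_target ℂ P))).differentiableAt (by simp)
  have h0 := (conformalFactor_pos g hχ (mem_chart_target ℂ P)).ne'
  simp only [rot, chartRot, dzLog, dz]
  set χ := chartAt ℂ P
  have hr := reCLM.hasFDerivAt.comp (χ P) hb.hasFDerivAt
  have hi := imCLM.hasFDerivAt.comp (χ P) hb.hasFDerivAt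
  have e1 : fderiv ℝ (fun w => conformalFactor g χ w * (chartVector b χ w).im) (χ P) = _ :=
    (hl.hasFDerivAt.mul hi).fderiv
  have e2 : fderiv ℝ (fun w => conformalFactor g χ w * (chartVector b χ w).re) (χ P) = _ :=
    (hl.hasFDerivAt.mul hr).fderiv
  have e3 : fderiv ℝ (fun w => (conformalFactor g χ w : ℂ)) (χ P) = _ :=
    (ofRealCLM.hasFDerivAt.comp (χ P) hl.hasFDerivAt).fderiv
  rw [e1, e2, e3]
  simp only [_root_.add_apply, _root_.smul_apply, ContinuousLinearMap.comp_apply, Function.comp,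
    reCLM_apply, imCLM_apply, ofRealCLM_apply, smul_eq_mul, add_im, mul_im, div_ofReal_re,
    div_ofReal_im, div_ofNat_im, div_ofNat_re, sub_re, sub_im, mul_re, ofReal_re, ofReal_im,
    I_re, I_im]
  field_simp
  ring

lemma CubicIntegrals.IsCubicIntegralOn.isRotorFieldAtIn
    (hK : ∀ φ ∈ atlas ℂ S, ∀ z ∈ φ.target, gaussCurvature g φ z = K) (hU : IsOpen U)
    (hF : IsCubicIntegralOn g U F) (hs : IsSmoothVectorFieldOn U b) (hb : HasFormOn g A b U F)
    (hφ : φ ∈ atlas ℂ S) {p : S} (hp : p ∈ φ.source) (hpU : p ∈ U) :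
    IsRotorFieldAtIn g A b (fun q => chartRot g b φ (φ q)) φ p := by
  have hz : φ p ∈ chartImage φ U :=
    ⟨φ.map_source hp, by rwa [Set.mem_preimage, φ.left_inv hp]⟩
  have hβ := (hs φ hφ).contDiffAt ((isOpen_chartImage φ hU).mem_nhds hz)
  refine ⟨hβ, ?_⟩
  refine ((poissonBracket_eq_zero_iff_isRotorSolutionAt hK hU hφ hz
    (hβ.differentiableAt (by simp)) fun w hw => hb.chartExpr_eq hφ hw).1
      ((hF φ hφ).2 _ hz)).congr_wirtinger ?_ rfl
  simp only [φ.left_inv hp, chartRot]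

lemma chartRot_congr {p : S} (hp : p ∈ φ.source)
    (h : ∀ᶠ q in nhds p, b q = b' q) : chartRot g b φ (φ p) = chartRot g b' φ (φ p) := by
  have hev : chartVector b φ =ᶠ[nhds (φ p)] chartVector b' φ := by
    have := (φ.continuousAt_symm (φ.map_source hp)).tendsto
    rw [φ.left_inv hp] at this
    exact (this.eventually h).mono fun z hz => chartVector_eq_of_eq hz
  rw [chartRot, chartRot, hev.dz.self_of_nhds, hev.self_of_nhds]

/-- A cubic integral on a connected domain is determined by the values of `b` and `rot b` at
one point. -/
theorem eq_of_isCubicIntegralOn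
    (hK : ∀ φ ∈ atlas ℂ S, ∀ z ∈ φ.target, gaussCurvature g φ z = K) (hU : IsOpen U)
    (hconn : IsPreconnected U) {F' : (p : S) → Cotangent p → ℝ}
    (hF : IsCubicIntegralOn g U F) (hs : IsSmoothVectorFieldOn U b) (hb : HasFormOn g A b U F)
    (hF' : IsCubicIntegralOn g U F') (hs' : IsSmoothVectorFieldOn U b')
    (hb' : HasFormOn g A b' U F') {P : S} (hP : P ∈ U) (hv : b P = b' P)
    (hw : rot g b P = rot g b' P) : ∀ p ∈ U, b p = b' p := by
  have key : ∀ x ∈ U, ∃ W, IsOpen W ∧ x ∈ W ∧ W ⊆ (chartAt ℂ x).source ∧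
      ∀ y ∈ W, b y = b' y → chartRot g b (chartAt ℂ x) (chartAt ℂ x y)
        = chartRot g b' (chartAt ℂ x) (chartAt ℂ x y) → ∀ p ∈ W, b p = b' p := by
    intro x hx
    obtain ⟨r, hr, hrU⟩ := exists_ball_subset_chartImage hU (mem_chart_source ℂ x) hx
    have hin : ∀ p ∈ chartBall (chartAt ℂ x) (chartAt ℂ x x) r, p ∈ U := fun p hp => by
      have := (hrU hp.2).2
      rwa [Set.mem_preimage, (chartAt ℂ x).left_inv hp.1] at this
    refine ⟨chartBall (chartAt ℂ x) (chartAt ℂ x x) r, isOpen_chartBall _ _ _,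
      mem_chartBall (mem_chart_source ℂ x) hr, Set.inter_subset_left, fun y hy hby hρ p hp =>
      (eqOn_chartBall (A := A) hK (chart_mem_atlas ℂ x) (hrU.trans Set.inter_subset_left)
        (fun q hq => hF.isRotorFieldAtIn hK hU hs hb (chart_mem_atlas ℂ x) hq.1 (hin q hq))
        (fun q hq => hF'.isRotorFieldAtIn hK hU hs' hb' (chart_mem_atlas ℂ x) hq.1 (hin q hq))
        hy hby hρ p hp).1⟩
  have hdiff : ∀ {b : (p : S) → TangentSpace 𝓘(ℝ, ℂ) p}, IsSmoothVectorFieldOn U b →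
      DifferentiableAt ℝ (chartVector b (chartAt ℂ P)) (chartAt ℂ P P) := fun h =>
    ((h _ (chart_mem_atlas ℂ P)).contDiffAt ((isOpen_chartImage _ hU).mem_nhds
      ⟨mem_chart_target ℂ P, by
        rwa [Set.mem_preimage, (chartAt ℂ P).left_inv (mem_chart_source ℂ P)]⟩)).differentiableAt
      (by simp)
  -- The set where the germs of b and b' agree is open. It is relatively closed in U because
  -- agreement of germs at one point of a small ball includes agreement of the rotors there, hence
  -- equality on the whole ball.
  have hsub : U ⊆ {p | ∀ᶠ q in nhds p, b q = b' q} := by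
    refine hconn.subset_of_closure_inter_subset isOpen_setOfPred_eventually_nhds ⟨P, hP, ?_⟩ ?_
    · obtain ⟨W, hWo, hPW, -, hW⟩ := key P hP
      rw [rot_eq_chartRot P (hdiff hs), rot_eq_chartRot P (hdiff hs')] at hw
      exact (hWo.eventually_mem hPW).mono (hW P hPW hv hw)
    · rintro x ⟨hx, hxU⟩
      obtain ⟨W, hWo, hxW, hWs, hW⟩ := key x hxU
      obtain ⟨y, hyW, hy⟩ := mem_closure_iff.1 hx W hWo hxW
      exact (hWo.eventually_mem hxW).mono (hW y hyW (Filter.Eventually.self_of_nhds (p := fun q => b q = b' q) hy)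
        (chartRot_congr (hWs hyW) hy))
  exact fun p hp => (hsub hp).self_of_nhds

end Integrals

/-! ### The main theorem. -/

theorem proposition3p1 {S : Type*} [TopologicalSpace S] [T2Space S] [ChartedSpace ℂ S]
    [IsManifold 𝓘(ℝ, ℂ) ∞ S] [IsManifold 𝓘(ℂ) ω S]
    (g : Metric S) (hg : IsIsothermic g) (hR : HasConstantCurvature g)
    (A : HolomorphicCodifferential S) :
    -- on any surface, compatibility near every point is equivalent to `D₀ = 0`
    ((∀ P : S, ∃ U : Set S, IsOpen U ∧ P ∈ U ∧ IsCompatibleOn g A U) ↔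
      D₀VanishesOn g A Set.univ) ∧
    -- on simply connected domains all assertions hold globally
    ∀ U : Set S, IsOpen U → IsSimplyConnected U →
      (IsCompatibleOn g A U ↔ D₀VanishesOn g A U) ∧
      (IsCompatibleOn g A U →
        ∀ P ∈ U, ∀ (v : TangentSpace 𝓘(ℝ, ℂ) P) (w : ℝ),
          ∃ F : (p : S) → Cotangent p → ℝ, IsIntegralWithData g A U P v w F ∧
            ∀ F' : (p : S) → Cotangent p → ℝ, IsIntegralWithData g A U P v w F' →
              ∀ p ∈ U, ∀ ξ : Cotangent p, F' p ξ = F p ξ) := by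
  obtain ⟨K, hK⟩ := hR
  refine ⟨⟨fun h φ hφ z hz => ?_, fun hD P => ?_⟩, fun U hU hsc => ⟨⟨fun h => h.d₀VanishesOn hK hU,
    fun hD => ?_⟩, fun h P hP v w => ?_⟩⟩
  · obtain ⟨U, hU, hPU, hc⟩ := h (φ.symm z)
    exact hc.d₀VanishesOn hK hU φ hφ z ⟨hz.1, hPU⟩
  -- Any initial values do for compatibility; zero is taken.
  · obtain ⟨r, hr, -, hex⟩ := exists_chartBall_isRotorFieldAt hg hK isOpen_univ hD
      (chart_mem_atlas ℂ P) (mem_chart_source ℂ P) (Set.mem_univ P)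
    have hPW := mem_chartBall (mem_chart_source ℂ P) hr
    obtain ⟨b, ρ, -, -, hb⟩ := hex P hPW 0 0
    exact ⟨_, isOpen_chartBall _ _ _, hPW,
      IsRotorFieldAt.isCompatibleOn hg hK (isOpen_chartBall _ _ _) hb⟩
  · obtain ⟨P, hP⟩ := hsc.nonempty
    obtain ⟨b, ρ, -, -, hb⟩ := exists_isRotorFieldAt hg hK hU hsc hD hP 0 0
    exact IsRotorFieldAt.isCompatibleOn hg hK hU hb
  · obtain ⟨b, ρ, hbP, hρP, hb⟩ :=
      exists_isRotorFieldAt hg hK hU hsc (h.d₀VanishesOn hK hU) hP v w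
    have hs := IsRotorFieldAt.isSmoothVectorFieldOn hb
    have hform := hasFormOn_cubicForm (A := A) (b := b) (U := U) hg
    have hint := IsRotorFieldAt.isCubicIntegralOn hK hU hb hform
    -- The auxiliary unknown ρ of the solution is the rotor of b, so the prescribed value of ρ at P
    -- is that of rot b.
    have hrot : rot g b P = w := by
      obtain ⟨h1, h2⟩ := hb P hP _ (chart_mem_atlas ℂ P) (mem_chart_source ℂ P)
      rw [rot_eq_chartRot P (h1.differentiableAt (by simp)), chartRot, ← h2.rotor_eq,
        (chartAt ℂ P).left_inv (mem_chart_source ℂ P), hρP]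
    refine ⟨cubicForm g A b, ⟨hint, b, hs, hform, hbP, hrot⟩, ?_⟩
    rintro F' ⟨hint', b', hs', hform', hbP', hrot'⟩ p hp ξ
    have := eq_of_isCubicIntegralOn hK hU hsc.isPathConnected.isConnected.isPreconnected
      hint hs hform hint' hs' hform' hP (hbP.trans hbP'.symm) (hrot.trans hrot'.symm) p hp
    rw [hform'.apply_eq_cubicForm hp, cubicForm, cubicForm, this]
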